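/- Let $a<b$ and let $\mathbb{P}^*$ be the law on $C([a,b])$ (with the Borel $\sigma$-field of the supremum norm) of a centred Gaussian process $f^*$ such that, for all $a\le x_1<\dots<x_n\le b$, the conditional mean of $f^*$ given $f^*(x_1),\dots,f^*(x_n)$ is, on $[x_1,x_n]$, the piecewise linear interpolant of these data. Assume that $\mathbb{P}^*$ is non-trivial, in the sense that the sample paths are not almost surely affine functions. Then there are $\lambda>0$ and $p,q,r\in\mathbb{R}$ with $$\operatorname{Cov}^*(f^*(x),f^*(y))=\lambda\min(x,y)+p+q(x+y)+rxy\qquad(x,y\in[a,b]),$$ where $\lambda$ is determined by $\mathbb{P}^*$ (shifted and scaled Wiener processes are the case $q=r=0$), such that the following holds. For $g\in C([\alpha,\beta])$ and $n\ge1$ let $\mathrm{Trap}(g,\alpha,\beta,n)=\frac{\beta-\alpha}{2n}\bigl(g(\alpha)+g(\beta)+2\sum_{i=1}^{n-1}g(\alpha+\tfrac{i(\beta-\alpha)}{n})\bigr)$. For $\rho>0$ and integers $m,k\ge1$, the recursive procedure $\mathrm{AdapTrap}_{\rho,m,k}(g,\alpha,\beta,\tau)$ computes $Q_1=\mathrm{Trap}(g,\alpha,\beta,m)$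 and $Q_2=\mathrm{Trap}(g,\alpha,\beta,2m)$; if $|Q_2-Q_1|<\tau$ it returns $Q_2$, and otherwise it returns $\sum_{i=0}^{k-1}\mathrm{AdapTrap}_{\rho,m,k}\bigl(g,\alpha+\tfrac{(\beta-\alpha)i}{k},\alpha+\tfrac{(\beta-\alpha)(i+1)}{k},\rho\tau\bigr)$. Let $\epsilon_{\rho,m,k,\tau}(f^*)=\int_a^b f^*(x)\,\mathrm{d}x-\mathrm{AdapTrap}_{\rho,m,k}(f^*,a,b,\tau)$ if the procedure terminates, and $\epsilon_{\rho,m,k,\tau}(f^*)=\infty$ otherwise. Then for all $\rho>0$, all integers $m\ge1$, all positive even integers $k$ and all $\tau>0$, $$\mathbb{P}^*\bigl(|\epsilon_{\rho,m,k,\tau}|>\tau\bigr)>\operatorname{erf}(c\tau)\bigl[1-\operatorname{erf}(\sqrt3\,c\tau)\bigr],\qquad c=2\sqrt2\,m\,\lambda^{-1/2}(b-a)^{-3/2},$$ where $\operatorname{erf}(x)=\frac1{\sqrt\pi}\int_{-x}^{x}e^{-t^2}\,\mathrm{d}t$. -/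

import Mathlib

open MeasureTheory ProbabilityTheory

noncomputable section

namespace AdaptiveCubature

/-- The error function `erf x = π^{-1/2} ∫_{-x}^{x} exp(-t²) dt`. -/
def erf (x : ℝ) : ℝ :=
  (1 / Real.sqrt Real.pi) * ∫ t in (-x)..x, Real.exp (-t ^ 2)

/-- The composite trapezoidal rule for `g` on `[a, b]` with `n` panels of equal length. -/
def trap (g : ℝ → ℝ) (a b : ℝ) (n : ℕ) : ℝ :=
  (b - a) / (2 * n) *
    (g a + g b + 2 * ∑ i ∈ Finset.Ico 1 n, g (a + i * (b - a) / n))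

/-- `AdapTrapReturns ρ m k g a b τ v`: the recursive procedure `AdapTrap_{ρ,m,k}(g, a, b, τ)`
terminates, and its output is `v`. The procedure computes `Q₁ = trap g a b m` and
`Q₂ = trap g a b (2 * m)`. It returns `Q₂` if `|Q₂ - Q₁| < τ`; otherwise it calls itself with
tolerance `ρ * τ` on each of the `k` subintervals of equal length and returns the sum of the
`k` results. A call terminates only if all the calls that it makes terminate. -/
inductive AdapTrapReturns (ρ : ℝ) (m k : ℕ) (g : ℝ → ℝ) : ℝ → ℝ → ℝ → ℝ → Prop
  | accept (a b τ : ℝ) (h : |trap g a b (2 * m) - trap g a b m| < τ) :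
      AdapTrapReturns ρ m k g a b τ (trap g a b (2 * m))
  | subdivide (a b τ : ℝ) (h : ¬ |trap g a b (2 * m) - trap g a b m| < τ) (v : Fin k → ℝ)
      (hv : ∀ i : Fin k, AdapTrapReturns ρ m k g
        (a + (b - a) * (i : ℕ) / k) (a + (b - a) * ((i : ℕ) + 1) / k) (ρ * τ) (v i)) :
      AdapTrapReturns ρ m k g a b τ (∑ i, v i)

/-- The procedure is deterministic: it has at most one output. -/
theorem AdapTrapReturns.unique {ρ : ℝ} {m k : ℕ} {g : ℝ → ℝ} {a b τ v w : ℝ}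
    (hv : AdapTrapReturns ρ m k g a b τ v) (hw : AdapTrapReturns ρ m k g a b τ w) : v = w := by
  induction hv generalizing w with
  | accept a b τ h =>
    cases hw with
    | accept _ _ _ _ => rfl
    | subdivide _ _ _ h' _ _ => exact absurd h h'
  | subdivide a b τ h v hv ih =>
    cases hw with
    | accept _ _ _ h' => exact absurd h' h
    | subdivide _ _ _ _ w hw => exact Finset.sum_congr rfl fun i _ => ih i (hw i)

open Classical in
/-- The signed error `∫_a^b g - AdapTrap_{ρ,m,k}(g, a, b, τ)` if the procedure terminates,
and `∞` otherwise. -/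
def adapTrapError (ρ : ℝ) (m k : ℕ) (τ a b : ℝ) (g : ℝ → ℝ) : EReal :=
  if h : ∃ v, AdapTrapReturns ρ m k g a b τ v then
    (((∫ x in a..b, g x) - h.choose : ℝ) : EReal)
  else ⊤

/-- If the procedure terminates with output `v`, the error is `∫_a^b g - v`. -/
theorem adapTrapError_eq {ρ : ℝ} {m k : ℕ} {τ a b : ℝ} {g : ℝ → ℝ} {v : ℝ}
    (hv : AdapTrapReturns ρ m k g a b τ v) :
    adapTrapError ρ m k τ a b g = (((∫ x in a..b, g x) - v : ℝ) : EReal) := by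
  have h : ∃ v, AdapTrapReturns ρ m k g a b τ v := ⟨v, hv⟩
  rw [adapTrapError, dif_pos h, h.choose_spec.unique hv]

/-- `C([a, b])` carries the Borel σ-algebra of the supremum norm. -/
instance instMeasurableSpaceContinuousMapIcc (a b : ℝ) : MeasurableSpace C(Set.Icc a b, ℝ) :=
  borel _

instance instBorelSpaceContinuousMapIcc (a b : ℝ) : BorelSpace C(Set.Icc a b, ℝ) := ⟨rfl⟩

/-- A law `P` on `C([a, b])` is that of a centred Gaussian process: the finite-dimensional
distributions are Gaussian (so `P` is a probability measure), with mean zero. -/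
structure IsCentredGaussianLaw {a b : ℝ} (P : Measure C(Set.Icc a b, ℝ)) : Prop where
  isGaussianProcess : IsGaussianProcess (fun (x : Set.Icc a b) (f : C(Set.Icc a b, ℝ)) => f x) P
  mean_eq_zero : ∀ x : Set.Icc a b, ∫ f, f x ∂P = 0

/-- The conditional mean of the process given finitely many data `f(x₀), …, f(xₙ)`, where
`x₀ < ⋯ < xₙ` lie in `[a, b]`, is on `[x₀, xₙ]` the piecewise linear interpolant of the data:
for `y` between the consecutive points `xᵢ` and `xᵢ₊₁`, the conditional expectation of `f(y)` is
the value at `y` of the line through `(xᵢ, f(xᵢ))` and `(xᵢ₊₁, f(xᵢ₊₁))`. -/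
def HasPiecewiseLinearConditionalMean {a b : ℝ} (P : Measure C(Set.Icc a b, ℝ)) : Prop :=
  ∀ (n : ℕ) (x : Fin (n + 1) → Set.Icc a b), StrictMono x →
    ∀ (i : Fin n) (y : Set.Icc a b), x i.castSucc ≤ y → y ≤ x i.succ →
      P[fun f : C(Set.Icc a b, ℝ) => f y |
          MeasurableSpace.comap (fun (f : C(Set.Icc a b, ℝ)) (j : Fin (n + 1)) => f (x j))
            inferInstance]
        =ᵐ[P] fun f =>
          (((x i.succ : ℝ) - y) * f (x i.castSucc) + ((y : ℝ) - x i.castSucc) * f (x i.succ))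
            / ((x i.succ : ℝ) - x i.castSucc)

/-- The degenerate case: almost every sample path is an affine function on `[a, b]`. -/
def IsAlmostSurelyAffine {a b : ℝ} (P : Measure C(Set.Icc a b, ℝ)) : Prop :=
  ∀ᵐ f ∂P, ∃ p q : ℝ, ∀ x : Set.Icc a b, f x = p + q * (x : ℝ)

end AdaptiveCubature

end

namespace AdaptiveCubature

/-! The interpolation error is orthogonal to the data, so the covariance kernel is affine in one
argument on every interval whose interior avoids the other. Such a kernel is `λ * min x y` plus a
symmetric bilinear form in affine functions (`exists_eq_mul_min_add`). The error of linear
interpolation between `a` and `b` has variance proportional to `λ`, so `λ ≤ 0` would force affine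
paths.

Halving all panels changes the trapezoidal rule by a sum of deviations `midDev` from chords. These
annihilate affine functions, so only `λ * min` contributes to their covariances, and `min s ·`
contributes only if its kink `s` lies inside the panel. Hence two refinements are uncorrelated as
soon as the nodes of one avoid the panel interiors of the other (`covariance_refine_eq_zero`). The
error of a trapezoidal rule is the limit of the sums of its successive refinements, so by
Gaussianity it is independent of the coarser refinements, with an explicit variance
(`iIndepFun_trapError_pathRefine`).

Two disjoint events give the bound. In the first, `|Q₂ - Q₁| < τ` and the error of `Q₂` exceeds `τ`;
by independence its probability is exactly the product of `erf` factors. In the second, the first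
call subdivides, all `k` subcalls accept, and the resulting composite rule has error above `τ`;
evenness of `k` makes the refinements involved independent, so this event has positive probability,
which makes the inequality strict. -/

open Filter Topology

/-! ### Trapezoidal sums and their refinement by halving. -/

/-- The composite trapezoidal rule on `n` panels of width `h`, starting at `α`. -/
noncomputable def panelTrap (g : ℝ → ℝ) (α h : ℝ) (n : ℕ) : ℝ :=
  ∑ j ∈ Finset.range n, h / 2 * (g (α + j * h) + g (α + (j + 1) * h))

/-- The deviation of `g` at `x` from the mean of its values at `x - h` and `x + h`. -/
noncomputable def midDev (g : ℝ → ℝ) (x h : ℝ) : ℝ := g x - (g (x - h) + g (x + h)) / 2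

/-- The change in the trapezoidal rule on `n` panels of width `2 * h`, starting at `α`, when every
panel is halved. -/
noncomputable def panelRefine (g : ℝ → ℝ) (α h : ℝ) (n : ℕ) : ℝ :=
  ∑ j ∈ Finset.range n, h * midDev g (α + (2 * j + 1) * h) h

theorem panelTrap_succ (g : ℝ → ℝ) (α h : ℝ) (n : ℕ) :
    panelTrap g α h (n + 1) =
      panelTrap g α h n + h / 2 * (g (α + n * h) + g (α + (n + 1) * h)) := by
  simp [panelTrap, Finset.sum_range_succ]

theorem trap_eq_panelTrap (g : ℝ → ℝ) (α β : ℝ) {n : ℕ} (hn : 0 < n) :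
    trap g α β n = panelTrap g α ((β - α) / n) n := by
  -- The width is decoupled from the number of panels, so that the induction on panels can keep it
  -- fixed.
  have key : ∀ (h : ℝ) (N : ℕ), panelTrap g α h (N + 1) = h / 2 *
      (g α + g (α + (N + 1) * h) + 2 * ∑ i ∈ Finset.Ico 1 (N + 1), g (α + i * h)) := by
    intro h N
    induction N with
    | zero => simp [panelTrap]
    | succ N ih =>
      rw [panelTrap_succ, ih, Finset.sum_Ico_succ_top (show 1 ≤ N + 1 by omega)]
      push_cast
      ring
  obtain ⟨N, rfl⟩ : ∃ N, n = N + 1 := ⟨n - 1, by omega⟩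
  have hN : ((N : ℝ) + 1) ≠ 0 := by positivity
  rw [key, trap]
  push_cast
  have e : α + (N + 1) * ((β - α) / (N + 1)) = β := by field_simp; ring
  simp only [mul_div_assoc, e]
  congr 1
  field_simp

theorem panelTrap_two_mul_sub (g : ℝ → ℝ) (α h : ℝ) (n : ℕ) :
    panelTrap g α h (2 * n) - panelTrap g α (2 * h) n = panelRefine g α h n := by
  induction n with
  | zero => simp [panelTrap, panelRefine]
  | succ n ih =>
    rw [show 2 * (n + 1) = 2 * n + 1 + 1 by ring, panelTrap_succ, panelTrap_succ, panelTrap_succ,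
      panelRefine, Finset.sum_range_succ, ← panelRefine, ← ih, midDev]
    push_cast
    rw [show α + (2 * n + 1) * h - h = α + 2 * n * h by ring,
      show α + (2 * n + 1) * h + h = α + (2 * n + 1 + 1) * h by ring,
      show α + n * (2 * h) = α + 2 * n * h by ring,
      show α + (n + 1) * (2 * h) = α + (2 * n + 1 + 1) * h by ring]
    ring

theorem trap_two_mul_sub_trap (g : ℝ → ℝ) (α β : ℝ) {n : ℕ} (hn : 0 < n) :
    trap g α β (2 * n) - trap g α β n = panelRefine g α ((β - α) / (2 * n)) n := by
  rw [trap_eq_panelTrap g α β (by omega), trap_eq_panelTrap g α β hn, ← panelTrap_two_mul_sub]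
  have hn' : (n : ℝ) ≠ 0 := by positivity
  push_cast
  congr 2
  field_simp

theorem panelTrap_add (g : ℝ → ℝ) (α h : ℝ) (m n : ℕ) :
    panelTrap g α h (m + n) = panelTrap g α h m + panelTrap g (α + m * h) h n := by
  rw [panelTrap, Finset.sum_range_add]
  simp only [panelTrap]
  congr 1
  refine Finset.sum_congr rfl fun j _ => ?_
  push_cast
  rw [show α + (m + j) * h = α + m * h + j * h by ring,
    show α + (m + j + 1) * h = α + m * h + (j + 1) * h by ring]

theorem sum_panelTrap (g : ℝ → ℝ) (α h : ℝ) (n k : ℕ) :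
    ∑ i ∈ Finset.range k, panelTrap g (α + (i * n : ℕ) * h) h n = panelTrap g α h (k * n) := by
  induction k with
  | zero => simp [panelTrap]
  | succ k ih => rw [Finset.sum_range_succ, ih, Nat.succ_mul, panelTrap_add]

theorem tendsto_panelTrap {g : ℝ → ℝ} (hg : Continuous g) {α β : ℝ} (hαβ : α < β)
    {N : ℕ → ℕ} (hN : Tendsto N atTop atTop) :
    Tendsto (fun l => panelTrap g α ((β - α) / N l) (N l)) atTop (𝓝 (∫ x in α..β, g x)) := by
  have hβ : 0 < β - α := sub_pos.2 hαβ
  rw [Metric.tendsto_atTop]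
  intro ε hε
  have huc := (isCompact_Icc (a := α) (b := β)).uniformContinuousOn_of_continuous hg.continuousOn
  rw [Metric.uniformContinuousOn_iff] at huc
  -- This tolerance gives an error of at most `ε / (2 * (β - α)) * h` per panel of width `h`, hence
  -- `ε / 2` in total.
  obtain ⟨δ, hδ, huc⟩ := huc (ε / (2 * (β - α))) (by positivity)
  have h0 : Tendsto (fun l => (β - α) / (N l : ℝ)) atTop (𝓝 0) :=
    tendsto_const_nhds.div_atTop (tendsto_natCast_atTop_atTop.comp hN)
  obtain ⟨L, hL⟩ := eventually_atTop.1
    ((h0.eventually (gt_mem_nhds hδ)).and (hN.eventually_gt_atTop 0))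
  refine ⟨L, fun l hl => ?_⟩
  obtain ⟨hs, hpos⟩ := hL l hl
  generalize N l = n at hs hpos
  set h := (β - α) / (n : ℝ) with hh
  have hn : (0 : ℝ) < n := by exact_mod_cast hpos
  have hh0 : 0 < h := by positivity
  have hnh : n * h = β - α := by rw [hh]; field_simp
  have hint : ∫ x in α..β, g x =
      ∑ j ∈ Finset.range n, ∫ x in (α + (j : ℕ) * h)..(α + (j + 1 : ℕ) * h), g x := by
    rw [intervalIntegral.sum_integral_adjacent_intervals (a := fun j : ℕ => α + j * h)
      fun _ _ => hg.intervalIntegrable _ _]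
    simp [hnh]
  rw [hint, panelTrap, Real.dist_eq, ← Finset.sum_sub_distrib]
  have hterm : ∀ j ∈ Finset.range n, |h / 2 * (g (α + j * h) + g (α + (j + 1) * h)) -
      ∫ x in (α + (j : ℕ) * h)..(α + (j + 1 : ℕ) * h), g x| ≤ ε / (2 * (β - α)) * h := by
    intro j hj
    have hj : ((j : ℝ) + 1) ≤ n := by exact_mod_cast Finset.mem_range.1 hj
    have hjn : ((j : ℝ) + 1) * h ≤ β - α := by rw [← hnh]; gcongr
    have hj0 : 0 ≤ (j : ℝ) * h := by positivity
    have hle : α + (j : ℕ) * h ≤ α + (j + 1 : ℕ) * h := by push_cast; linarith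
    have e : h / 2 * (g (α + j * h) + g (α + (j + 1) * h)) =
        ∫ x in (α + (j : ℕ) * h)..(α + (j + 1 : ℕ) * h),
          (g (α + j * h) + g (α + (j + 1) * h)) / 2 := by
      rw [intervalIntegral.integral_const, smul_eq_mul]
      push_cast
      ring
    rw [e, ← intervalIntegral.integral_sub (by simp) (hg.intervalIntegrable _ _)]
    have := intervalIntegral.norm_integral_le_of_norm_le_const (a := α + (j : ℕ) * h)
      (b := α + (j + 1 : ℕ) * h) (C := ε / (2 * (β - α)))
      (f := fun x => (g (α + j * h) + g (α + (j + 1) * h)) / 2 - g x) ?_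
    · refine this.trans (le_of_eq ?_)
      rw [abs_of_nonneg (by linarith)]
      push_cast
      ring
    · intro x hx
      rw [Set.uIoc_of_le hle] at hx
      push_cast at hx
      obtain ⟨hx1, hx2⟩ := hx
      have hxm : x ∈ Set.Icc α β := ⟨by linarith, by linarith⟩
      have h1 := huc (α + j * h) ⟨by linarith, by linarith⟩ x hxm
        (by rw [Real.dist_eq, abs_lt]; constructor <;> linarith)
      have h2 := huc (α + (j + 1) * h) ⟨by linarith, by linarith⟩ x hxm
        (by rw [Real.dist_eq, abs_lt]; constructor <;> linarith)
      rw [Real.dist_eq, abs_lt] at h1 h2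
      rw [Real.norm_eq_abs, abs_le]
      constructor <;> linarith [h1.1, h1.2, h2.1, h2.2]
  calc _ ≤ ∑ j ∈ Finset.range n, ε / (2 * (β - α)) * h :=
        (Finset.abs_sum_le_sum_abs _ _).trans (Finset.sum_le_sum hterm)
    _ = ε / 2 := by
        rw [Finset.sum_const, Finset.card_range, nsmul_eq_mul, mul_left_comm, hnh]
        field_simp
    _ < ε := by linarith

theorem panelTrap_add_sum_refine (g : ℝ → ℝ) (α h : ℝ) (n L : ℕ) :
    panelTrap g α (h / 2 ^ L) (2 ^ L * n) - panelTrap g α h n =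
      ∑ l ∈ Finset.range L, panelRefine g α (h / 2 ^ (l + 1)) (2 ^ l * n) := by
  induction L with
  | zero => simp
  | succ L ih =>
    rw [Finset.sum_range_succ, ← ih, ← panelTrap_two_mul_sub,
      show 2 ^ (L + 1) * n = 2 * (2 ^ L * n) by ring,
      show 2 * (h / 2 ^ (L + 1)) = h / 2 ^ L by rw [pow_succ]; field_simp]
    ring

/-- The error of the trapezoidal rule is the sum of the changes under repeated halving. -/
theorem tendsto_sum_refine {g : ℝ → ℝ} (hg : Continuous g) {α β : ℝ} (hαβ : α < β) {n : ℕ}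
    (hn : 0 < n) :
    Tendsto (fun L => ∑ l ∈ Finset.range L,
        panelRefine g α ((β - α) / n / 2 ^ (l + 1)) (2 ^ l * n)) atTop
      (𝓝 ((∫ x in α..β, g x) - trap g α β n)) := by
  have hN : Tendsto (fun L : ℕ => 2 ^ L * n) atTop atTop :=
    (tendsto_pow_atTop_atTop_of_one_lt (by norm_num : 1 < 2)).atTop_mul_const' hn
  have := (tendsto_panelTrap hg hαβ hN).sub_const (trap g α β n)
  refine this.congr fun L => ?_
  rw [← panelTrap_add_sum_refine, trap_eq_panelTrap g α β hn]
  congr 2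
  push_cast
  field_simp

/-! ### Outcomes of the procedure at recursion depth zero and one. -/

theorem adapTrapError_of_accept {ρ τ a b : ℝ} {m k : ℕ} {g : ℝ → ℝ}
    (h : |trap g a b (2 * m) - trap g a b m| < τ) :
    adapTrapError ρ m k τ a b g = (((∫ x in a..b, g x) - trap g a b (2 * m) : ℝ) : EReal) :=
  adapTrapError_eq (.accept a b τ h)

/-- If the first call subdivides and all the calls that it makes accept, then the output is a
trapezoidal rule on the whole interval. -/
theorem adapTrapError_of_subdivide {ρ τ a b : ℝ} {m k : ℕ} (hm : 0 < m) (hk : 0 < k) {g : ℝ → ℝ}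
    (h : ¬ |trap g a b (2 * m) - trap g a b m| < τ)
    (hsub : ∀ i < k, |trap g (a + (b - a) * i / k) (a + (b - a) * (i + 1) / k) (2 * m) -
      trap g (a + (b - a) * i / k) (a + (b - a) * (i + 1) / k) m| < ρ * τ) :
    adapTrapError ρ m k τ a b g =
      (((∫ x in a..b, g x) - trap g a b (k * (2 * m)) : ℝ) : EReal) := by
  have hm' : (m : ℝ) ≠ 0 := by positivity
  have hk' : (k : ℝ) ≠ 0 := by positivity
  have key : ∑ i : Fin k, trap g (a + (b - a) * (i : ℕ) / k) (a + (b - a) * ((i : ℕ) + 1) / k)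
      (2 * m) = trap g a b (k * (2 * m)) := by
    rw [Fin.sum_univ_eq_sum_range
      (fun i : ℕ => trap g (a + (b - a) * i / k) (a + (b - a) * (i + 1) / k) (2 * m)),
      trap_eq_panelTrap g a b (by positivity), ← sum_panelTrap]
    refine Finset.sum_congr rfl fun i _ => ?_
    rw [trap_eq_panelTrap _ _ _ (by positivity)]
    congr 1
    · push_cast
      field_simp
    · push_cast
      field_simp
      ring
  rw [← key]
  exact adapTrapError_eq (.subdivide a b τ h _ fun i => .accept _ _ _ (hsub i i.2))

/-! ### Independence of Gaussian limits, and Gaussian probabilities in terms of `erf`. -/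

/-- Pointwise limits of uncorrelated centred jointly Gaussian families are independent centred
Gaussian random variables. -/
theorem iIndepFun_of_tendsto_gaussian {Ω ι : Type*} [MeasurableSpace Ω] [Fintype ι]
    {P : Measure Ω} [IsProbabilityMeasure P] {G : Submodule ℝ (Ω → ℝ)}
    (hG : ∀ X ∈ G, HasGaussianLaw X P) (hG0 : ∀ X ∈ G, P[X] = 0)
    {U : ℕ → ι → Ω → ℝ} (hU : ∀ N i, U N i ∈ G)
    (hcov : ∀ N i j, i ≠ j → cov[U N i, U N j; P] = 0)
    {X : ι → Ω → ℝ} (hX : ∀ i, Measurable (X i))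
    (hUX : ∀ i ω, Tendsto (fun N => U N i ω) atTop (𝓝 (X i ω)))
    {v : ι → NNReal} (hv : ∀ i, Tendsto (fun N => Var[U N i; P]) atTop (𝓝 (v i))) :
    iIndepFun X P ∧ ∀ i, P.map (X i) = gaussianReal 0 (v i) := by
  classical
  -- The joint characteristic function factorises for each `N`, because the covariance matrix is
  -- diagonal, and dominated convergence carries this to the limit. It yields both the marginals and
  -- their independence.
  have hchar : ∀ t : ι → ℝ, ∫ ω, Complex.exp ((∑ i, t i * X i ω : ℝ) * Complex.I) ∂P =
      Complex.exp (-(∑ i, v i * t i ^ 2 : ℝ) / 2) := by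
    intro t
    have hN : ∀ N, ∫ ω, Complex.exp ((∑ i, t i * U N i ω : ℝ) * Complex.I) ∂P =
        Complex.exp (-(∑ i, Var[U N i; P] * t i ^ 2 : ℝ) / 2) := by
      intro N
      have hmem : (∑ i, t i • U N i) ∈ G :=
        G.sum_mem fun i _ => G.smul_mem _ (hU N i)
      have hg := hG _ hmem
      have hm := fun i => (hG _ (hU N i)).memLp_two
      have hvar : Var[∑ i, t i • U N i; P] = ∑ i, Var[U N i; P] * t i ^ 2 := by
        rw [← covariance_self hg.aemeasurable,
          covariance_sum_sum (fun i => (hm i).const_smul _) (fun i => (hm i).const_smul _)]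
        refine Finset.sum_congr rfl fun i _ => ?_
        rw [Finset.sum_eq_single i]
        · rw [covariance_smul_left, covariance_smul_right,
            covariance_self (hG _ (hU N i)).aemeasurable]
          ring
        · intro j _ hj
          rw [covariance_smul_left, covariance_smul_right, hcov N i j (Ne.symm hj)]
          simp
        · simp
      have h1 := charFun_apply_real (μ := P.map (∑ i, t i • U N i)) 1
      rw [hg.map_eq_gaussianReal, charFun_gaussianReal, ← hg.map_eq_gaussianReal,
        integral_map hg.aemeasurable (by fun_prop), hG0 _ hmem, hvar,
        Real.coe_toNNReal _ (Finset.sum_nonneg fun i _ =>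
          mul_nonneg (variance_nonneg _ _) (sq_nonneg _))] at h1
      simp only [Finset.sum_apply, Pi.smul_apply, smul_eq_mul] at h1
      convert! h1.symm using 2
      · simp
      · simp [neg_div]
    have hl : Tendsto (fun N => ∫ ω, Complex.exp ((∑ i, t i * U N i ω : ℝ) * Complex.I) ∂P) atTop
        (𝓝 (∫ ω, Complex.exp ((∑ i, t i * X i ω : ℝ) * Complex.I) ∂P)) := by
      refine tendsto_integral_of_dominated_convergence (fun _ => 1) (fun N => ?_)
        (integrable_const _) (fun N => ?_) ?_
      · have := fun i => (hG _ (hU N i)).aemeasurable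
        exact AEMeasurable.aestronglyMeasurable (by fun_prop)
      · exact .of_forall fun ω => (Complex.norm_exp_ofReal_mul_I _).le
      · refine .of_forall fun ω => ?_
        have : Tendsto (fun N => ∑ i, t i * U N i ω) atTop (𝓝 (∑ i, t i * X i ω)) :=
          tendsto_finsetSum _ fun i _ => (hUX i ω).const_mul _
        have hc : Continuous fun x : ℝ => Complex.exp (x * Complex.I) := by fun_prop
        exact (hc.tendsto _).comp this
    refine tendsto_nhds_unique hl ?_
    simp_rw [hN]
    have : Tendsto (fun N => ∑ i, Var[U N i; P] * t i ^ 2) atTop (𝓝 (∑ i, v i * t i ^ 2)) :=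
      tendsto_finsetSum _ fun i _ => (hv i).mul_const _
    have hc : Continuous fun x : ℝ => Complex.exp (-(x : ℂ) / 2) := by fun_prop
    exact (hc.tendsto _).comp this
  have hlaw : ∀ i, P.map (X i) = gaussianReal 0 (v i) := by
    intro i
    have := Measure.isProbabilityMeasure_map (μ := P) (hX i).aemeasurable
    refine Measure.ext_of_charFun (funext fun s => ?_)
    rw [charFun_gaussianReal, charFun_apply_real, integral_map (hX i).aemeasurable (by fun_prop)]
    -- A vector `t` supported at `i` extracts the characteristic function of `X i`.
    have := hchar (Pi.single i s)
    simp only [Pi.single_apply, ite_mul, zero_mul, Finset.sum_ite_eq', Finset.mem_univ,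
      if_true, ite_pow, mul_ite, ne_eq, OfNat.ofNat_ne_zero, not_false_eq_true, zero_pow,
      mul_zero] at this
    convert! this using 2
    · simp
    · simp [neg_div]
  refine ⟨?_, hlaw⟩
  rw [iIndepFun_iff_charFun_pi fun i => (hX i).aemeasurable]
  intro t
  have hm : Measurable fun ω => WithLp.toLp 2 (fun i => X i ω) := by fun_prop
  rw [charFun_apply, integral_map hm.aemeasurable (by fun_prop)]
  simp_rw [hlaw, charFun_gaussianReal, ← Complex.exp_sum]
  convert! hchar (fun i => t i) using 2
  simp [neg_div, Finset.sum_div]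

theorem gaussianReal_real_Ioo (v : NNReal) (hv : v ≠ 0) {s : ℝ} (hs : 0 ≤ s) :
    (gaussianReal 0 v).real (Set.Ioo (-s) s) = erf (s / Real.sqrt (2 * v)) := by
  have hv' : (0 : ℝ) < v := by positivity
  have hsq : 0 < Real.sqrt (2 * v) := by positivity
  rw [Measure.real, gaussianReal_apply_eq_integral _ hv,
    ENNReal.toReal_ofReal (integral_nonneg fun x => gaussianPDFReal_nonneg _ _ _),
    ← integral_Ioc_eq_integral_Ioo, ← intervalIntegral.integral_of_le (by linarith), erf]
  -- Substitution `t = x / √(2v)`.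
  have h := intervalIntegral.integral_comp_div (fun t => Real.exp (-t ^ 2)) hsq.ne' (a := -s)
    (b := s)
  rw [← neg_div, ← inv_smul_eq_iff₀ hsq.ne'] at *
  rw [← h, smul_eq_mul, ← mul_assoc, ← intervalIntegral.integral_const_mul]
  refine intervalIntegral.integral_congr fun x _ => ?_
  simp only [gaussianPDFReal, sub_zero, div_pow, Real.sq_sqrt (by positivity : 0 ≤ 2 * (v : ℝ)),
    neg_div]
  congr 1
  rw [one_div, ← mul_inv, ← Real.sqrt_mul (by positivity)]
  ring_nf

theorem gaussianReal_real_abs_lt (v : NNReal) (hv : v ≠ 0) {s : ℝ} (hs : 0 ≤ s) :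
    (gaussianReal 0 v).real {x | |x| < s} = erf (s / Real.sqrt (2 * v)) := by
  rw [← gaussianReal_real_Ioo v hv hs]
  congr 1
  ext x
  simp [abs_lt]

theorem gaussianReal_real_lt_abs (v : NNReal) (hv : v ≠ 0) {s : ℝ} (hs : 0 ≤ s) :
    (gaussianReal 0 v).real {x | s < |x|} = 1 - erf (s / Real.sqrt (2 * v)) := by
  have := nullSingletonClass_gaussianReal (μ := 0) hv
  have h : {x : ℝ | s < |x|} = (Set.Icc (-s) s)ᶜ := by
    ext x
    simp only [Set.mem_ofPred_eq, Set.mem_compl_iff, Set.mem_Icc, ← abs_le, not_le]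
  rw [h, probReal_compl_eq_one_sub measurableSet_Icc, ← gaussianReal_real_Ioo v hv hs,
    measureReal_congr Ioo_ae_eq_Icc]

theorem gaussianReal_pos_of_isOpen (v : NNReal) (hv : v ≠ 0) {s t : Set ℝ} (hs : IsOpen s)
    (hne : s.Nonempty) (hst : s ⊆ t) : 0 < gaussianReal 0 v t := by
  refine lt_of_lt_of_le (pos_iff_ne_zero.2 fun h => ?_) (measure_mono hst)
  exact (hs.measure_pos volume hne).ne' (gaussianReal_absolutelyContinuous' 0 hv h)

theorem gaussianReal_abs_lt_pos (v : NNReal) (hv : v ≠ 0) {s : ℝ} (hs : 0 < s) :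
    0 < gaussianReal 0 v {x | |x| < s} :=
  gaussianReal_pos_of_isOpen v hv (isOpen_lt continuous_abs continuous_const) ⟨0, by simpa⟩ le_rfl

theorem gaussianReal_lt_abs_pos (v : NNReal) (hv : v ≠ 0) (s : ℝ) :
    0 < gaussianReal 0 v {x | s < |x|} :=
  gaussianReal_pos_of_isOpen v hv (isOpen_lt continuous_const continuous_abs)
    ⟨|s| + 1, by
      rw [Set.mem_ofPred_eq, abs_of_pos (by positivity)]
      linarith [le_abs_self s]⟩ le_rfl

/-! ### Covariances of refinements. -/

section Covariance

variable {Ω : Type*} [MeasurableSpace Ω] {P : Measure Ω} {Z : ℝ → Ω → ℝ} {a b lam p q r : ℝ}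

theorem covariance_sub_half_add [IsFiniteMeasure P] {A B C Y : Ω → ℝ} (hA : MemLp A 2 P)
    (hB : MemLp B 2 P) (hC : MemLp C 2 P) (hY : MemLp Y 2 P) :
    cov[fun ω => A ω - (B ω + C ω) / 2, Y; P] =
      cov[A, Y; P] - (cov[B, Y; P] + cov[C, Y; P]) / 2 := by
  have hBC : MemLp (fun ω => (B ω + C ω) / 2) 2 P := by
    simpa [div_eq_mul_inv] using (hB.add hC).mul_const (2⁻¹)
  rw [covariance_fun_sub_left hA hBC hY, covariance_fun_div_left]
  congr 2
  exact covariance_add_left hB hC hY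

theorem memLp_midDev (hZ : ∀ x, MemLp (Z x) 2 P) (x h : ℝ) :
    MemLp (fun ω => midDev (Z · ω) x h) 2 P := by
  have := (hZ x).sub (((hZ (x - h)).add (hZ (x + h))).mul_const (2⁻¹))
  convert! this using 2

theorem covariance_midDev_left [IsFiniteMeasure P] (hZ : ∀ x, MemLp (Z x) 2 P) {Y : Ω → ℝ}
    (hY : MemLp Y 2 P) (x h : ℝ) :
    cov[fun ω => midDev (Z · ω) x h, Y; P] = midDev (fun s => cov[Z s, Y; P]) x h :=
  covariance_sub_half_add (hZ _) (hZ _) (hZ _) hY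

/-- The terms with `p`, `q`, `r` are affine in each argument, so `midDev` removes them. -/
theorem covariance_midDev_midDev [IsFiniteMeasure P] (hZ : ∀ x, MemLp (Z x) 2 P)
    (hK : ∀ x ∈ Set.Icc a b, ∀ y ∈ Set.Icc a b,
      cov[Z x, Z y; P] = lam * min x y + p + q * (x + y) + r * (x * y))
    {x h y l : ℝ} (hx : a ≤ x - h) (hx' : x + h ≤ b) (hy : a ≤ y - l) (hy' : y + l ≤ b)
    (hh : 0 ≤ h) (hl : 0 ≤ l) :
    cov[fun ω => midDev (Z · ω) x h, fun ω => midDev (Z · ω) y l; P] =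
      lam * midDev (fun s => midDev (fun t => min s t) y l) x h := by
  have key : ∀ s ∈ Set.Icc a b, cov[Z s, fun ω => midDev (Z · ω) y l; P] =
      lam * midDev (fun t => min s t) y l := by
    intro s hs
    rw [covariance_comm, covariance_midDev_left hZ (hZ s), midDev, midDev,
      hK y ⟨by linarith, by linarith⟩ s hs, hK (y - l) ⟨by linarith, by linarith⟩ s hs,
      hK (y + l) ⟨by linarith, by linarith⟩ s hs, min_comm s, min_comm s, min_comm s]
    ring
  rw [covariance_midDev_left hZ (memLp_midDev hZ y l), midDev,
    key x ⟨by linarith, by linarith⟩, key (x - h) ⟨by linarith, by linarith⟩,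
    key (x + h) ⟨by linarith, by linarith⟩]
  simp only [midDev]
  ring

/-- The only kink of `min s ·` is at `s`; away from the interior of the panel the function is affine
there. -/
theorem midDev_min_eq_zero {s y l : ℝ} (hl : 0 ≤ l) (hs : s ≤ y - l ∨ y + l ≤ s) :
    midDev (fun t => min s t) y l = 0 := by
  rw [midDev]
  rcases hs with hs | hs
  · rw [min_eq_left (by linarith), min_eq_left hs, min_eq_left (by linarith)]
    ring
  · rw [min_eq_right (by linarith), min_eq_right (by linarith), min_eq_right hs]
    ring

theorem midDev_midDev_min_self {x h : ℝ} (hh : 0 ≤ h) :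
    midDev (fun s => midDev (fun t => min s t) x h) x h = h / 2 := by
  rw [midDev, midDev_min_eq_zero hh (.inl le_rfl), midDev_min_eq_zero hh (.inr le_rfl), midDev,
    min_self, min_eq_right (by linarith), min_eq_left (by linarith)]
  ring

theorem memLp_refine (hZ : ∀ x, MemLp (Z x) 2 P) (α h : ℝ) (n : ℕ) :
    MemLp (fun ω => panelRefine (Z · ω) α h n) 2 P :=
  memLp_finsetSum _ fun _ _ => (memLp_midDev hZ _ _).const_mul _

theorem covariance_refine_refine [IsFiniteMeasure P] (hZ : ∀ x, MemLp (Z x) 2 P)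
    (hK : ∀ x ∈ Set.Icc a b, ∀ y ∈ Set.Icc a b,
      cov[Z x, Z y; P] = lam * min x y + p + q * (x + y) + r * (x * y))
    {α h β l : ℝ} {m n : ℕ} (hα : a ≤ α) (hα' : α + 2 * m * h ≤ b) (hh : 0 ≤ h)
    (hβ : a ≤ β) (hβ' : β + 2 * n * l ≤ b) (hl : 0 ≤ l) :
    cov[fun ω => panelRefine (Z · ω) α h m, fun ω => panelRefine (Z · ω) β l n; P] =
      ∑ i ∈ Finset.range m, ∑ j ∈ Finset.range n, h * (l * (lam *
        midDev (fun s => midDev (fun t => min s t) (β + (2 * j + 1) * l) l)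
          (α + (2 * i + 1) * h) h)) := by
  simp only [panelRefine]
  rw [covariance_fun_sum_fun_sum' (fun i _ => (memLp_midDev hZ _ _).const_mul _)
    (fun i _ => (memLp_midDev hZ _ _).const_mul _)]
  refine Finset.sum_congr rfl fun i hi => Finset.sum_congr rfl fun j hj => ?_
  have hi : ((i : ℝ) + 1) ≤ m := by exact_mod_cast Finset.mem_range.1 hi
  have hj : ((j : ℝ) + 1) ≤ n := by exact_mod_cast Finset.mem_range.1 hj
  have hi1 : ((i : ℝ) + 1) * h ≤ m * h := by gcongr
  have hj1 : ((j : ℝ) + 1) * l ≤ n * l := by gcongr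
  have hi0 : 0 ≤ (i : ℝ) * h := by positivity
  have hj0 : 0 ≤ (j : ℝ) * l := by positivity
  rw [covariance_const_mul_left, covariance_const_mul_right,
    covariance_midDev_midDev hZ hK (by linarith) (by linarith) (by linarith) (by linarith) hh hl]

/-- Refinements are uncorrelated if the nodes of the first one do not meet the interior of any
panel of the second one. -/
theorem covariance_refine_eq_zero [IsFiniteMeasure P] (hZ : ∀ x, MemLp (Z x) 2 P)
    (hK : ∀ x ∈ Set.Icc a b, ∀ y ∈ Set.Icc a b,
      cov[Z x, Z y; P] = lam * min x y + p + q * (x + y) + r * (x * y))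
    {α h β l : ℝ} {m n : ℕ} (hα : a ≤ α) (hα' : α + 2 * m * h ≤ b) (hh : 0 ≤ h)
    (hβ : a ≤ β) (hβ' : β + 2 * n * l ≤ b) (hl : 0 ≤ l)
    (hnodes : ∀ t ≤ 2 * m, ∀ j < n,
      α + t * h ≤ β + 2 * j * l ∨ β + 2 * (j + 1) * l ≤ α + t * h) :
    cov[fun ω => panelRefine (Z · ω) α h m, fun ω => panelRefine (Z · ω) β l n; P] = 0 := by
  rw [covariance_refine_refine hZ hK hα hα' hh hβ hβ' hl]
  refine Finset.sum_eq_zero fun i hi => Finset.sum_eq_zero fun j hj => ?_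
  rw [Finset.mem_range] at hi hj
  have key : ∀ t ≤ 2 * m, ∀ s, s = α + t * h →
      midDev (fun t => min s t) (β + (2 * j + 1) * l) l = 0 := by
    rintro t ht s rfl
    refine midDev_min_eq_zero hl ((hnodes t ht j hj).imp (fun H => ?_) fun H => ?_) <;> linarith
  rw [midDev, key (2 * i + 1) (by omega) _ (by push_cast; ring),
    key (2 * i) (by omega) _ (by push_cast; ring),
    key (2 * i + 2) (by omega) _ (by push_cast; ring)]
  simp

/-- All nodes of the first refinement lie on the lattice generated by the panel endpoints of the
second, and a lattice point is never inside a panel. -/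
theorem covariance_refine_eq_zero_of_lattice [IsFiniteMeasure P] (hZ : ∀ x, MemLp (Z x) 2 P)
    (hK : ∀ x ∈ Set.Icc a b, ∀ y ∈ Set.Icc a b,
      cov[Z x, Z y; P] = lam * min x y + p + q * (x + y) + r * (x * y))
    {α h β l : ℝ} {m n : ℕ} (hα : a ≤ α) (hα' : α + 2 * m * h ≤ b) (hh : 0 ≤ h)
    (hβ : a ≤ β) (hβ' : β + 2 * n * l ≤ b) (hl : 0 ≤ l)
    (u v : ℤ) (hu : α = β + 2 * l * u) (hv : h = 2 * l * v) :
    cov[fun ω => panelRefine (Z · ω) α h m, fun ω => panelRefine (Z · ω) β l n; P] = 0 := by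
  refine covariance_refine_eq_zero hZ hK hα hα' hh hβ hβ' hl fun t _ j _ => ?_
  have e : α + t * h = β + 2 * l * ((u + t * v : ℤ) : ℝ) := by rw [hu, hv]; push_cast; ring
  rw [e]
  rcases le_or_gt (u + t * v) j with H | H
  · have H : ((u + t * v : ℤ) : ℝ) ≤ j := by exact_mod_cast H
    have := mul_le_mul_of_nonneg_left H hl
    left
    linarith
  · have H : (j : ℝ) + 1 ≤ ((u + t * v : ℤ) : ℝ) := by exact_mod_cast H
    have := mul_le_mul_of_nonneg_left H hl
    right
    linarith

theorem covariance_refine_eq_zero_of_disjoint [IsFiniteMeasure P] (hZ : ∀ x, MemLp (Z x) 2 P)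
    (hK : ∀ x ∈ Set.Icc a b, ∀ y ∈ Set.Icc a b,
      cov[Z x, Z y; P] = lam * min x y + p + q * (x + y) + r * (x * y))
    {α h β l : ℝ} {m n : ℕ} (hα : a ≤ α) (hα' : α + 2 * m * h ≤ b) (hh : 0 ≤ h)
    (hβ : a ≤ β) (hβ' : β + 2 * n * l ≤ b) (hl : 0 ≤ l) (hdisj : α + 2 * m * h ≤ β) :
    cov[fun ω => panelRefine (Z · ω) α h m, fun ω => panelRefine (Z · ω) β l n; P] = 0 := by
  refine covariance_refine_eq_zero hZ hK hα hα' hh hβ hβ' hl fun t ht j _ => .inl ?_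
  have ht : (t : ℝ) ≤ 2 * m := by exact_mod_cast ht
  have h1 : t * h ≤ 2 * m * h := by gcongr
  have h2 : 0 ≤ 2 * j * l := by positivity
  linarith

/-- Distinct panels of one refinement are uncorrelated, and each contributes `h ^ 2 * (lam * h /
2)`. -/
theorem variance_refine [IsFiniteMeasure P] (hZ : ∀ x, MemLp (Z x) 2 P)
    (hK : ∀ x ∈ Set.Icc a b, ∀ y ∈ Set.Icc a b,
      cov[Z x, Z y; P] = lam * min x y + p + q * (x + y) + r * (x * y))
    {α h : ℝ} {n : ℕ} (hα : a ≤ α) (hα' : α + 2 * n * h ≤ b) (hh : 0 ≤ h) :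
    Var[fun ω => panelRefine (Z · ω) α h n; P] = lam * n * h ^ 3 / 2 := by
  rw [← covariance_self (memLp_refine hZ _ _ _).aemeasurable,
    covariance_refine_refine hZ hK hα hα' hh hα hα' hh]
  have key : ∀ i ∈ Finset.range n, ∑ j ∈ Finset.range n, h * (h * (lam *
      midDev (fun s => midDev (fun t => min s t) (α + (2 * j + 1) * h) h)
        (α + (2 * i + 1) * h) h)) = lam * h ^ 3 / 2 := by
    intro i hi
    rw [Finset.sum_eq_single_of_mem i hi, midDev_midDev_min_self hh]
    · ring
    · intro j _ hji
      have hz : ∀ s, s ≤ α + (2 * j + 1) * h - h ∨ α + (2 * j + 1) * h + h ≤ s →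
          midDev (fun t => min s t) (α + (2 * j + 1) * h) h = 0 := fun s => midDev_min_eq_zero hh
      rcases hji.lt_or_gt with H | H
      · have H : ((j : ℝ) + 1) ≤ i := by exact_mod_cast H
        have H := mul_le_mul_of_nonneg_right H hh
        rw [midDev, hz _ (.inr ?_), hz _ (.inr ?_), hz _ (.inr ?_)]
        · simp
        all_goals linarith
      · have H : ((i : ℝ) + 1) ≤ j := by exact_mod_cast H
        have H := mul_le_mul_of_nonneg_right H hh
        rw [midDev, hz _ (.inl ?_), hz _ (.inl ?_), hz _ (.inl ?_)]
        · simp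
        all_goals linarith
  rw [Finset.sum_congr rfl key, Finset.sum_const, Finset.card_range, nsmul_eq_mul]
  ring

end Covariance

/-! ### The form of the covariance kernel. -/

/-- A symmetric kernel on `[a, b]` that is affine in its first argument on every interval whose
interior does not contain the second argument is that of a scaled Wiener process, up to a
symmetric bilinear form in affine functions. -/
theorem exists_eq_mul_min_add {a b : ℝ} (hab : a < b) {K : ℝ → ℝ → ℝ}
    (hsymm : ∀ x y, K x y = K y x)
    (hK : ∀ x ∈ Set.Icc a b, ∀ z ∈ Set.Icc a b, x < z → ∀ y, x ≤ y → y ≤ z →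
      ∀ u ∈ Set.Icc a b, u ≤ x ∨ z ≤ u →
        (z - x) * K y u = (z - y) * K x u + (y - x) * K z u) :
    ∃ lam p q r : ℝ, ∀ x ∈ Set.Icc a b, ∀ y ∈ Set.Icc a b,
      K x y = lam * min x y + p + q * (x + y) + r * (x * y) := by
  have hba : b - a ≠ 0 := (sub_pos.2 hab).ne'
  have ha : a ∈ Set.Icc a b := ⟨le_rfl, hab.le⟩
  have hb : b ∈ Set.Icc a b := ⟨hab.le, le_rfl⟩
  set c := (a + b) / 2 with hc
  have hac : a < c := by rw [hc]; linarith
  have hcb : c < b := by rw [hc]; linarith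
  have hcm : c ∈ Set.Icc a b := ⟨hac.le, hcb.le⟩
  -- The difference `D` below has to vanish at `(c, c)`, `(a, a)`, `(a, b)` and `(b, b)`. The first
  -- condition fixes `lam`, since the interpolation error at the midpoint should have variance `lam
  -- * (b - a) / 4`; the other three fix `p`, `q`, `r`.
  set lam := 4 * (K c c - (K a a + 2 * K a b + K b b) / 4) / (b - a) with hlam
  set A := K a a - lam * a with hA
  set B := K a b - lam * a with hB
  set C := K b b - lam * b with hC
  set p := (b ^ 2 * A - 2 * a * b * B + a ^ 2 * C) / (b - a) ^ 2 with hp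
  set q := (-b * A + (a + b) * B - a * C) / (b - a) ^ 2 with hq
  set r := (A - 2 * B + C) / (b - a) ^ 2 with hr
  set D : ℝ → ℝ → ℝ := fun x y => K x y - (lam * min x y + p + q * (x + y) + r * (x * y)) with hD
  have Dsymm : ∀ x y, D x y = D y x := by
    intro x y
    simp only [hD, hsymm x y, min_comm x y]
    ring
  have hDlin : ∀ x ∈ Set.Icc a b, ∀ z ∈ Set.Icc a b, x < z → ∀ y, x ≤ y → y ≤ z →
      ∀ u ∈ Set.Icc a b, u ≤ x ∨ z ≤ u →
        (z - x) * D y u = (z - y) * D x u + (y - x) * D z u := by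
    intro x hx z hz hxz y hxy hyz u hu h
    have := hK x hx z hz hxz y hxy hyz u hu h
    simp only [hD]
    rcases h with h | h
    · rw [min_eq_right h, min_eq_right (h.trans hxy), min_eq_right (h.trans hxz.le)]
      linear_combination this
    · rw [min_eq_left h, min_eq_left (hyz.trans h), min_eq_left (hxz.le.trans h)]
      linear_combination this
  have Daa : D a a = 0 := by
    simp only [hD, min_self, hp, hq, hr, hA]
    field_simp
    ring
  have Dab : D a b = 0 := by
    simp only [hD, min_eq_left hab.le, hp, hq, hr, hB]
    field_simp
    ring
  have Dbb : D b b = 0 := by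
    simp only [hD, min_self, hp, hq, hr, hC]
    field_simp
    ring
  have Dcc : D c c = 0 := by
    have e : lam * (b - a) = 4 * (K c c - (K a a + 2 * K a b + K b b) / 4) := by
      rw [hlam]; field_simp
    have e' : p + q * (c + c) + r * (c * c) = (A + 2 * B + C) / 4 := by
      clear_value A B C
      rw [hp, hq, hr, hc]
      field_simp
      ring
    simp only [hD, min_self]
    linear_combination -e' - e / 4 - lam * hc - hA / 4 - hB / 2 - hC / 4
  -- `D` satisfies the same affinity condition as `K`. Vanishing at the corners spreads to the edges
  -- of the square, and vanishing at `(c, c)` spreads first to the diagonal and then to the whole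
  -- square.
  have Da : ∀ t ∈ Set.Icc a b, D a t = 0 := by
    intro t ht
    have := hDlin a ha b hb hab t ht.1 ht.2 a ha (.inl le_rfl)
    rw [Daa, Dsymm b, Dab, Dsymm t] at this
    simpa [hba] using this
  have Db : ∀ t ∈ Set.Icc a b, D t b = 0 := by
    intro t ht
    have := hDlin a ha b hb hab t ht.1 ht.2 b hb (.inr le_rfl)
    rw [Dab, Dbb] at this
    simpa [hba] using this
  have up : ∀ s ∈ Set.Icc a b, s < b → ∀ t, s ≤ t → t ≤ b →
      (b - s) * D s t = (b - t) * D s s := by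
    intro s hs hsb t hst htb
    have := hDlin s hs b hb hsb t hst htb s hs (.inl le_rfl)
    rwa [Dsymm b, Db s hs, Dsymm t, mul_zero, add_zero] at this
  have down : ∀ t ∈ Set.Icc a b, a < t → ∀ s, a ≤ s → s ≤ t →
      (t - a) * D s t = (s - a) * D t t := by
    intro t ht hat s has hst
    have := hDlin a ha t ht hat s has hst t ht (.inr le_rfl)
    rwa [Da t ht, mul_zero, zero_add] at this
  -- From `(c, c)`, move with one argument fixed at `c` to the off-diagonal point with arguments `c`
  -- and `t`, then with one argument fixed at `t` to `(t, t)`.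
  have diag : ∀ t ∈ Set.Icc a b, D t t = 0 := by
    intro t ht
    rcases le_total c t with h | h
    · have h1 := up c hcm hcb t h ht.2
      rw [Dcc, mul_zero] at h1
      have h2 := down t ht (hac.trans_le h) c hac.le h
      rw [(mul_eq_zero.1 h1).resolve_left (sub_pos.2 hcb).ne', mul_zero] at h2
      exact (mul_eq_zero.1 h2.symm).resolve_left (sub_pos.2 hac).ne'
    · have h1 := down c hcm hac t ht.1 h
      rw [Dcc, mul_zero] at h1
      have h2 := up t ht (h.trans_lt hcb) c h hcb.le
      rw [(mul_eq_zero.1 h1).resolve_left (sub_pos.2 hac).ne', mul_zero] at h2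
      exact (mul_eq_zero.1 h2.symm).resolve_left (sub_pos.2 hcb).ne'
  have upper : ∀ s ∈ Set.Icc a b, ∀ t ∈ Set.Icc a b, s ≤ t → D s t = 0 := by
    intro s hs t ht hst
    rcases hs.2.eq_or_lt with rfl | hsb
    · rw [le_antisymm ht.2 hst]
      exact Dbb
    · have := up s hs hsb t hst ht.2
      rw [diag s hs, mul_zero] at this
      exact (mul_eq_zero.1 this).resolve_left (sub_pos.2 hsb).ne'
  refine ⟨lam, p, q, r, fun x hx y hy => sub_eq_zero.1 ?_⟩
  change D x y = 0
  rcases le_total x y with h | h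
  · exact upper x hx y hy h
  · rw [Dsymm]
    exact upper y hy x hx h

/-! ### Consequences of the hypotheses on the law. -/

section Law

variable {a b : ℝ} {P : Measure C(Set.Icc a b, ℝ)}

/-- The value of a path at `x`, for paths extended by constants from `[a, b]` to `ℝ`. -/
noncomputable def pathEval (hab : a ≤ b) (x : ℝ) (f : C(Set.Icc a b, ℝ)) : ℝ :=
  Set.IccExtend hab f x

theorem pathEval_of_mem (hab : a ≤ b) {x : ℝ} (hx : x ∈ Set.Icc a b) :
    pathEval hab x = fun f : C(Set.Icc a b, ℝ) => f ⟨x, hx⟩ :=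
  funext fun f => Set.IccExtend_of_mem hab f hx

theorem IsCentredGaussianLaw.isGaussianProcess_pathEval (hP : IsCentredGaussianLaw P)
    (hab : a ≤ b) : IsGaussianProcess (pathEval hab) P :=
  hP.isGaussianProcess.comp_right (Set.projIcc a b hab)

theorem IsCentredGaussianLaw.integral_pathEval (hP : IsCentredGaussianLaw P) (hab : a ≤ b)
    (x : ℝ) : P[pathEval hab x] = 0 :=
  hP.mean_eq_zero _

theorem IsCentredGaussianLaw.memLp (hP : IsCentredGaussianLaw P) (x : Set.Icc a b) :
    MemLp (fun f : C(Set.Icc a b, ℝ) => f x) 2 P :=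
  (hP.isGaussianProcess.hasGaussianLaw_eval x).memLp_two

theorem IsCentredGaussianLaw.isProbabilityMeasure (hP : IsCentredGaussianLaw P) :
    IsProbabilityMeasure P :=
  hP.isGaussianProcess.isProbabilityMeasure

theorem IsCentredGaussianLaw.covariance_eq (hP : IsCentredGaussianLaw P) (x y : Set.Icc a b) :
    cov[fun f : C(Set.Icc a b, ℝ) => f x, fun f : C(Set.Icc a b, ℝ) => f y; P] =
      ∫ f, f x * f y ∂P := by
  simp [covariance, hP.mean_eq_zero]

theorem measurable_eval (x : Set.Icc a b) : Measurable fun f : C(Set.Icc a b, ℝ) => f x :=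
  (ContinuousEvalConst.continuous_eval_const x).measurable

/-- The interpolation error is uncorrelated with the data. -/
theorem HasPiecewiseLinearConditionalMean.covariance (hP : IsCentredGaussianLaw P)
    (hlin : HasPiecewiseLinearConditionalMean P) {n : ℕ} (x : Fin (n + 1) → Set.Icc a b)
    (hx : StrictMono x) (i : Fin n) {y : Set.Icc a b} (hy : x i.castSucc ≤ y)
    (hy' : y ≤ x i.succ) (j : Fin (n + 1)) :
    ((x i.succ : ℝ) - x i.castSucc) *
        cov[fun f : C(Set.Icc a b, ℝ) => f y, fun f : C(Set.Icc a b, ℝ) => f (x j); P] =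
      ((x i.succ : ℝ) - y) * cov[fun f : C(Set.Icc a b, ℝ) => f (x i.castSucc),
          fun f : C(Set.Icc a b, ℝ) => f (x j); P] +
        ((y : ℝ) - x i.castSucc) * cov[fun f : C(Set.Icc a b, ℝ) => f (x i.succ),
          fun f : C(Set.Icc a b, ℝ) => f (x j); P] := by
  have := hP.isProbabilityMeasure
  have hd : ((x i.succ : ℝ) - x i.castSucc) ≠ 0 :=
    (sub_pos.2 (Subtype.coe_lt_coe.2 (hx i.castSucc_lt_succ))).ne'
  have hm : MeasurableSpace.comap
      (fun (f : C(Set.Icc a b, ℝ)) (j : Fin (n + 1)) => f (x j)) inferInstance ≤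
      instMeasurableSpaceContinuousMapIcc a b :=
    (measurable_pi_lambda _ fun j => measurable_eval (x j)).comap_le
  have hsm : StronglyMeasurable[MeasurableSpace.comap
      (fun (f : C(Set.Icc a b, ℝ)) (j : Fin (n + 1)) => f (x j)) inferInstance]
      (fun f : C(Set.Icc a b, ℝ) => f (x j)) :=
    ((measurable_pi_apply j).comp (comap_measurable
      fun (f : C(Set.Icc a b, ℝ)) (j : Fin (n + 1)) => f (x j))).stronglyMeasurable
  have hint : ∀ s t, Integrable (fun f : C(Set.Icc a b, ℝ) => f s * f t) P :=
    fun s t => (hP.memLp s).integrable_mul (hP.memLp t)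
  -- The datum `f (x j)` is measurable for the conditioning σ-algebra, so it can be pulled out of
  -- the conditional expectation before the interpolant is inserted.
  have h1 := condExp_mul_of_stronglyMeasurable_right hsm (hint y (x j))
    ((hP.memLp y).integrable one_le_two)
  have h2 := hlin n x hx i y hy hy'
  have h3 : ∫ f, f y * f (x j) ∂P = ∫ f, (P[(fun f : C(Set.Icc a b, ℝ) => f y) *
      fun f : C(Set.Icc a b, ℝ) => f (x j) | MeasurableSpace.comap
        (fun (f : C(Set.Icc a b, ℝ)) (j : Fin (n + 1)) => f (x j)) inferInstance]) f ∂P :=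
    (integral_condExp hm).symm
  rw [hP.covariance_eq, hP.covariance_eq, hP.covariance_eq, h3, integral_congr_ae h1,
    ← integral_const_mul, ← integral_const_mul, ← integral_const_mul,
    ← integral_add ((hint _ _).const_mul _) ((hint _ _).const_mul _)]
  refine integral_congr_ae (h2.mono fun f hf => ?_)
  simp only [Pi.mul_apply, hf]
  field_simp

theorem HasPiecewiseLinearConditionalMean.exists_covariance_eq (hab : a < b)
    (hP : IsCentredGaussianLaw P) (hlin : HasPiecewiseLinearConditionalMean P) :
    ∃ lam p q r : ℝ, ∀ x ∈ Set.Icc a b, ∀ y ∈ Set.Icc a b,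
      cov[pathEval hab.le x, pathEval hab.le y; P] =
        lam * min x y + p + q * (x + y) + r * (x * y) := by
  refine exists_eq_mul_min_add hab (fun x y => covariance_comm _ _) ?_
  intro x hx z hz hxz y hxy hyz u hu h
  have hy : y ∈ Set.Icc a b := ⟨hx.1.trans hxy, hyz.trans hz.2⟩
  rw [pathEval_of_mem _ hx, pathEval_of_mem _ hy, pathEval_of_mem _ hz, pathEval_of_mem _ hu]
  have base : StrictMono ![(⟨x, hx⟩ : Set.Icc a b), ⟨z, hz⟩] := by
    rw [Fin.strictMono_iff_lt_succ]
    intro i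
    fin_cases i
    simpa using hxz
  -- The point `u` must be one of the data. If it is `x` or `z`, two data points suffice; otherwise
  -- it is added on its side of `[x, z]`, where it leaves `x` and `z` consecutive.
  rcases h with h | h <;> rcases h.eq_or_lt with h | h
  · subst h
    exact hlin.covariance hP _ base 0 (y := ⟨y, hy⟩) hxy hyz 0
  · have hs : StrictMono ![(⟨u, hu⟩ : Set.Icc a b), ⟨x, hx⟩, ⟨z, hz⟩] := by
      rw [Fin.strictMono_iff_lt_succ]
      intro i
      fin_cases i
      · simpa using h
      · simpa using hxz
    exact hlin.covariance hP _ hs 1 (y := ⟨y, hy⟩) hxy hyz 0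
  · subst h
    exact hlin.covariance hP _ base 0 (y := ⟨y, hy⟩) hxy hyz 1
  · have hs : StrictMono ![(⟨x, hx⟩ : Set.Icc a b), ⟨z, hz⟩, ⟨u, hu⟩] := by
      rw [Fin.strictMono_iff_lt_succ]
      intro i
      fin_cases i
      · simpa using hxz
      · simpa using h
    exact hlin.covariance hP _ hs 0 (y := ⟨y, hy⟩) hxy hyz 2

theorem IsCentredGaussianLaw.memLp_pathEval (hP : IsCentredGaussianLaw P) (hab : a ≤ b) (x : ℝ) :
    MemLp (pathEval hab x) 2 P :=
  hP.memLp _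

theorem IsCentredGaussianLaw.hasGaussianLaw_of_mem_span (hP : IsCentredGaussianLaw P)
    (hab : a ≤ b) {X : C(Set.Icc a b, ℝ) → ℝ}
    (hX : X ∈ Submodule.span ℝ (Set.range (pathEval hab))) : HasGaussianLaw X P := by
  obtain ⟨c, rfl⟩ := Finsupp.mem_span_range_iff_exists_finsupp.1 hX
  exact ((hP.isGaussianProcess_pathEval hab).smul c).hasGaussianLaw_sum

theorem IsCentredGaussianLaw.integral_of_mem_span (hP : IsCentredGaussianLaw P)
    (hab : a ≤ b) {X : C(Set.Icc a b, ℝ) → ℝ}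
    (hX : X ∈ Submodule.span ℝ (Set.range (pathEval hab))) : P[X] = 0 := by
  have := hP.isProbabilityMeasure
  induction hX using Submodule.span_induction with
  | mem X h =>
    obtain ⟨x, rfl⟩ := h
    exact hP.integral_pathEval hab x
  | zero => simp
  | add X Y hX hY ihX ihY =>
    have h := integral_add (hP.hasGaussianLaw_of_mem_span hab hX).integrable
      (hP.hasGaussianLaw_of_mem_span hab hY).integrable
    simpa [ihX, ihY] using h
  | smul c X hX ih => simp [integral_const_mul, ih]

theorem refine_mem_span (hab : a ≤ b) (α h : ℝ) (n : ℕ) :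
    (fun f : C(Set.Icc a b, ℝ) => panelRefine (fun x => pathEval hab x f) α h n) ∈
      Submodule.span ℝ (Set.range (pathEval hab)) := by
  have hev : ∀ x, pathEval hab x ∈ Submodule.span ℝ (Set.range (pathEval hab)) :=
    fun x => Submodule.subset_span ⟨x, rfl⟩
  have : (fun f : C(Set.Icc a b, ℝ) => panelRefine (fun x => pathEval hab x f) α h n) =
      ∑ j ∈ Finset.range n, h • (pathEval hab (α + (2 * j + 1) * h) -
        (2⁻¹ : ℝ) • (pathEval hab (α + (2 * j + 1) * h - h) +
          pathEval hab (α + (2 * j + 1) * h + h))) := by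
    ext f
    simp only [panelRefine, midDev, Finset.sum_apply, Pi.smul_apply, Pi.sub_apply, Pi.add_apply,
      smul_eq_mul]
    refine Finset.sum_congr rfl fun j _ => ?_
    ring
  rw [this]
  exact Submodule.sum_mem _ fun j _ => Submodule.smul_mem _ _ (Submodule.sub_mem _ (hev _)
    (Submodule.smul_mem _ _ (Submodule.add_mem _ (hev _) (hev _))))

/-- The variance of the error of linear interpolation between the endpoints. -/
theorem variance_interpolation_error [IsFiniteMeasure P] (hab : a < b) {lam p q r : ℝ}
    (hP : IsCentredGaussianLaw P)
    (hK : ∀ x ∈ Set.Icc a b, ∀ y ∈ Set.Icc a b,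
      cov[pathEval hab.le x, pathEval hab.le y; P] =
        lam * min x y + p + q * (x + y) + r * (x * y)) {y : ℝ} (hy : y ∈ Set.Icc a b) :
    Var[fun f => pathEval hab.le y f - ((b - y) / (b - a) * pathEval hab.le a f +
      (y - a) / (b - a) * pathEval hab.le b f); P] = lam * ((y - a) * (b - y) / (b - a)) := by
  have ha : a ∈ Set.Icc a b := ⟨le_rfl, hab.le⟩
  have hb : b ∈ Set.Icc a b := ⟨hab.le, le_rfl⟩
  have hm := fun x => hP.memLp_pathEval hab.le x
  have hma := (hm a).const_mul ((b - y) / (b - a))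
  have hmb := (hm b).const_mul ((y - a) / (b - a))
  have hadd := hma.add hmb
  have hba : b - a ≠ 0 := (sub_pos.2 hab).ne'
  change Var[pathEval hab.le y - ((fun f => (b - y) / (b - a) * pathEval hab.le a f) +
    fun f => (y - a) / (b - a) * pathEval hab.le b f); P] = _
  rw [← covariance_self ((hm y).sub hadd).aemeasurable,
    covariance_sub_left (hm y) hadd ((hm y).sub hadd), covariance_add_left hma hmb
    ((hm y).sub hadd), covariance_sub_right (hm y) (hm y) hadd, covariance_sub_right hma (hm y)
    hadd, covariance_sub_right hmb (hm y) hadd, covariance_add_right (hm y) hma hmb,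
    covariance_add_right hma hma hmb, covariance_add_right hmb hma hmb]
  simp only [covariance_const_mul_left, covariance_const_mul_right]
  rw [hK y hy y hy, hK y hy a ha, hK y hy b hb, hK a ha y hy, hK b hb y hy, hK a ha a ha,
    hK a ha b hb, hK b hb a ha, hK b hb b hb]
  simp only [min_self, min_eq_left hy.1, min_eq_right hy.1, min_eq_left hy.2, min_eq_right hy.2,
    min_eq_left hab.le, min_eq_right hab.le]
  field_simp
  ring

theorem pos_of_not_isAlmostSurelyAffine (hab : a < b) {lam p q r : ℝ}
    (hP : IsCentredGaussianLaw P) (hnontriv : ¬ IsAlmostSurelyAffine P)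
    (hK : ∀ x ∈ Set.Icc a b, ∀ y ∈ Set.Icc a b,
      cov[pathEval hab.le x, pathEval hab.le y; P] =
        lam * min x y + p + q * (x + y) + r * (x * y)) : 0 < lam := by
  have := hP.isProbabilityMeasure
  by_contra! hle
  apply hnontriv
  have hba : 0 < b - a := sub_pos.2 hab
  -- With `lam ≤ 0` the interpolation error has variance at most zero, so this centred variable
  -- vanishes almost surely.
  have hzero : ∀ y : Set.Icc a b, ∀ᵐ f ∂P,
      f y = (b - y) / (b - a) * pathEval hab.le a f + (y - a) / (b - a) * pathEval hab.le b f := by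
    intro y
    have hv := variance_interpolation_error hab hP hK y.2
    set X : C(Set.Icc a b, ℝ) → ℝ := fun f => pathEval hab.le y f -
      ((b - y) / (b - a) * pathEval hab.le a f + (y - a) / (b - a) * pathEval hab.le b f) with hX
    have hmem : X ∈ Submodule.span ℝ (Set.range (pathEval hab.le)) := by
      have hev : ∀ x, pathEval hab.le x ∈ Submodule.span ℝ (Set.range (pathEval hab.le)) :=
        fun x => Submodule.subset_span ⟨x, rfl⟩
      exact Submodule.sub_mem _ (hev y) (Submodule.add_mem _
        (Submodule.smul_mem _ ((b - y) / (b - a)) (hev a))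
        (Submodule.smul_mem _ ((y - a) / (b - a)) (hev b)))
    have h0 : Var[X; P] = 0 := by
      refine le_antisymm ?_ (variance_nonneg _ _)
      rw [hv]
      refine mul_nonpos_of_nonpos_of_nonneg hle ?_
      have := sub_nonneg.2 y.2.1
      have := sub_nonneg.2 y.2.2
      positivity
    have hL := (hP.hasGaussianLaw_of_mem_span hab.le hmem).memLp_two
    have hX0 := ae_eq_integral_of_variance_eq_zero hL h0
    filter_upwards [hX0] with f hf
    rw [hP.integral_of_mem_span hab.le hmem] at hf
    have e := congrFun (pathEval_of_mem hab.le y.2) f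
    simp only [hX, e] at hf
    linarith
  -- The exceptional null set depends on `y`; a countable dense set of points and continuity of the
  -- paths give one null set for all of them.
  obtain ⟨s, hs, hd⟩ := TopologicalSpace.exists_countable_dense (Set.Icc a b)
  have hall := (ae_ball_iff hs).2 fun y _ => hzero y
  filter_upwards [hall] with f hf
  refine ⟨(b * pathEval hab.le a f - a * pathEval hab.le b f) / (b - a),
    (pathEval hab.le b f - pathEval hab.le a f) / (b - a), fun x => ?_⟩
  have := Continuous.ext_on hd f.continuous (g := fun x : Set.Icc a b =>
    (b - x) / (b - a) * pathEval hab.le a f + (x - a) / (b - a) * pathEval hab.le b f)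
    (by fun_prop) hf
  rw [congrFun this x]
  field_simp
  ring

end Law

/-! ### Law of the trapezoidal error and probabilities of the two failure events. -/

section Error

variable {a b lam p q r : ℝ} {P : Measure C(Set.Icc a b, ℝ)}

/-- The error of the trapezoidal rule on `n` panels, as a function of the path. -/
noncomputable def trapError (hab : a ≤ b) (n : ℕ) (f : C(Set.Icc a b, ℝ)) : ℝ :=
  (∫ x in a..b, pathEval hab x f) - trap (fun x => pathEval hab x f) a b n

/-- The change in the trapezoidal rule under one refinement, as a function of the path. -/
noncomputable def pathRefine (hab : a ≤ b) (α h : ℝ) (n : ℕ) (f : C(Set.Icc a b, ℝ)) : ℝ :=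
  panelRefine (fun x => pathEval hab x f) α h n

/-- The change in the trapezoidal rule on `n` panels after `N` halvings of all panels. -/
noncomputable def refineSum (hab : a ≤ b) (n N : ℕ) : C(Set.Icc a b, ℝ) → ℝ :=
  ∑ l ∈ Finset.range N, pathRefine hab a ((b - a) / n / 2 ^ (l + 1)) (2 ^ l * n)

theorem refineSum_mem_span (hab : a ≤ b) (n N : ℕ) :
    refineSum hab n N ∈ Submodule.span ℝ (Set.range (pathEval hab)) :=
  Submodule.sum_mem _ fun _ _ => refine_mem_span hab _ _ _

theorem tendsto_refineSum (hab : a < b) {n : ℕ} (hn : 0 < n) (f : C(Set.Icc a b, ℝ)) :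
    Tendsto (fun N => refineSum hab.le n N f) atTop (𝓝 (trapError hab.le n f)) := by
  have hc : Continuous fun x => pathEval hab.le x f := f.continuous.Icc_extend'
  simpa [refineSum, pathRefine, trapError] using tendsto_sum_refine hc hab hn

theorem measurable_pathRefine (hab : a ≤ b) (α h : ℝ) (n : ℕ) :
    Measurable (pathRefine hab α h n) := by
  have hm : ∀ x, Measurable (pathEval hab x) := fun x => measurable_eval _
  unfold pathRefine panelRefine midDev
  fun_prop

theorem measurable_trapError (hab : a < b) {n : ℕ} (hn : 0 < n) :
    Measurable (trapError hab.le n) := by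
  refine measurable_of_tendsto_metrizable (f := fun N => refineSum hab.le n N) (fun N => ?_)
    (tendsto_pi_nhds.2 fun f => tendsto_refineSum hab hn f)
  have := Finset.measurable_sum (Finset.range N) fun l _ =>
    measurable_pathRefine hab.le a ((b - a) / n / 2 ^ (l + 1)) (2 ^ l * n)
  convert! this using 1
  ext f
  simp [refineSum]

theorem covariance_pathRefine_eq_zero_of_lattice (hP : IsCentredGaussianLaw P) (hab : a < b)
    (hK : ∀ x ∈ Set.Icc a b, ∀ y ∈ Set.Icc a b,
      cov[pathEval hab.le x, pathEval hab.le y; P] =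
        lam * min x y + p + q * (x + y) + r * (x * y))
    {α h : ℝ} {m n : ℕ} (hn : 0 < n) (hα : a ≤ α) (hα' : α + 2 * m * h ≤ b) (hh : 0 ≤ h)
    (u v : ℤ) (hu : α = a + (b - a) / n * u) (hv : h = (b - a) / n * v) (l : ℕ) :
    cov[pathRefine hab.le α h m,
      pathRefine hab.le a ((b - a) / n / 2 ^ (l + 1)) (2 ^ l * n); P] = 0 := by
  have := hP.isProbabilityMeasure
  have hba := sub_pos.2 hab
  refine covariance_refine_eq_zero_of_lattice (fun x => hP.memLp_pathEval hab.le x) hK hα hα' hh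
    le_rfl (le_of_eq ?_) (by positivity) (2 ^ l * u) (2 ^ l * v) ?_ ?_
  · push_cast
    field_simp
    ring
  · rw [hu]
    push_cast
    field_simp
    ring
  · rw [hv]
    push_cast
    field_simp
    ring

theorem memLp_pathRefine (hP : IsCentredGaussianLaw P) (hab : a ≤ b) (α h : ℝ) (n : ℕ) :
    MemLp (pathRefine hab α h n) 2 P :=
  (hP.hasGaussianLaw_of_mem_span hab (refine_mem_span hab α h n)).memLp_two

theorem variance_refineSum (hP : IsCentredGaussianLaw P) (hab : a < b)
    (hK : ∀ x ∈ Set.Icc a b, ∀ y ∈ Set.Icc a b,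
      cov[pathEval hab.le x, pathEval hab.le y; P] =
        lam * min x y + p + q * (x + y) + r * (x * y)) {n : ℕ} (hn : 0 < n) (N : ℕ) :
    Var[refineSum hab.le n N; P] =
      ∑ l ∈ Finset.range N, lam * (b - a) ^ 3 / (16 * n ^ 2) * (1 / 4) ^ l := by
  have := hP.isProbabilityMeasure
  have hba := sub_pos.2 hab
  have hm := fun l : ℕ => memLp_pathRefine hP hab.le a ((b - a) / n / 2 ^ (l + 1)) (2 ^ l * n)
  have hbound : ∀ l : ℕ,
      a + 2 * ((2 ^ l * n : ℕ) : ℝ) * ((b - a) / n / 2 ^ (l + 1)) = b := by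
    intro l
    push_cast
    field_simp
    ring
  have hlt : ∀ i j : ℕ, i < j →
      cov[pathRefine hab.le a ((b - a) / n / 2 ^ (i + 1)) (2 ^ i * n),
        pathRefine hab.le a ((b - a) / n / 2 ^ (j + 1)) (2 ^ j * n); P] = 0 := by
    intro i j hij
    obtain ⟨d, rfl⟩ := Nat.exists_eq_add_of_lt hij
    -- With `j = i + d + 1`, the node spacing at level `i` is `2 ^ d` panels of level `j`.
    refine covariance_refine_eq_zero_of_lattice (fun x => hP.memLp_pathEval hab.le x) hK le_rfl
      (hbound i).le (by positivity) le_rfl (hbound _).le (by positivity) 0 (2 ^ d) (by simp) ?_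
    push_cast
    rw [show i + d + 1 + 1 = (i + 1) + d + 1 by ring, pow_succ _ ((i + 1) + d), pow_add]
    field_simp
    ring
  rw [refineSum, variance_sum' fun l _ => hm l]
  refine Finset.sum_congr rfl fun i hi => ?_
  rw [Finset.sum_eq_single_of_mem i hi]
  · rw [covariance_self (hm i).aemeasurable]
    refine (variance_refine (fun x => hP.memLp_pathEval hab.le x) hK le_rfl
      (hbound i).le (by positivity)).trans ?_
    have h4 : (4 : ℝ) ^ i = 2 ^ i * 2 ^ i := by rw [← mul_pow]; norm_num
    push_cast
    rw [one_div, inv_pow, h4, pow_succ]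
    field_simp
    ring
  · intro j _ hji
    rcases hji.lt_or_gt with H | H
    · rw [covariance_comm]
      exact hlt j i H
    · exact hlt i j H

theorem tendsto_variance_refineSum (hP : IsCentredGaussianLaw P) (hab : a < b)
    (hK : ∀ x ∈ Set.Icc a b, ∀ y ∈ Set.Icc a b,
      cov[pathEval hab.le x, pathEval hab.le y; P] =
        lam * min x y + p + q * (x + y) + r * (x * y)) {n : ℕ} (hn : 0 < n) :
    Tendsto (fun N => Var[refineSum hab.le n N; P]) atTop
      (𝓝 (lam * (b - a) ^ 3 / (12 * n ^ 2))) := by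
  simp_rw [variance_refineSum hP hab hK hn]
  -- The ratio `1 / 4` contributes the factor `4 / 3`, which turns `1 / 16` into `1 / 12`.
  have := ((hasSum_geometric_of_lt_one (r := 1 / 4) (by norm_num) (by norm_num)).mul_left
    (lam * (b - a) ^ 3 / (16 * n ^ 2))).tendsto_sum_nat
  convert! this using 2
  field_simp
  ring

/-- The changes under uncorrelated coarse refinements are independent of each other and of the
error of a finer trapezoidal rule. -/
theorem iIndepFun_trapError_pathRefine (hP : IsCentredGaussianLaw P) (hab : a < b)
    (hlam : 0 < lam)
    (hK : ∀ x ∈ Set.Icc a b, ∀ y ∈ Set.Icc a b,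
      cov[pathEval hab.le x, pathEval hab.le y; P] =
        lam * min x y + p + q * (x + y) + r * (x * y))
    {n : ℕ} (hn : 0 < n) {J : Type*} [Fintype J] (α h : J → ℝ) (m : J → ℕ)
    (hα : ∀ j, a ≤ α j) (hα' : ∀ j, α j + 2 * m j * h j ≤ b) (hh : ∀ j, 0 ≤ h j)
    (u v : J → ℤ) (hu : ∀ j, α j = a + (b - a) / n * u j) (hv : ∀ j, h j = (b - a) / n * v j)
    (hcov : ∀ i j, i ≠ j →
      cov[pathRefine hab.le (α i) (h i) (m i), pathRefine hab.le (α j) (h j) (m j); P] = 0) :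
    iIndepFun (fun o : Option J => o.elim (trapError hab.le n)
        fun j => pathRefine hab.le (α j) (h j) (m j)) P ∧
      ∀ o : Option J, P.map (o.elim (trapError hab.le n)
        fun j => pathRefine hab.le (α j) (h j) (m j)) = gaussianReal 0
          (o.elim (lam * (b - a) ^ 3 / (12 * n ^ 2)) fun j => lam * m j * h j ^ 3 / 2).toNNReal := by
  have := hP.isProbabilityMeasure
  have hba := sub_pos.2 hab
  -- By `hu` and `hv` the nodes of each coarse refinement are nodes of the `n`-panel rule, so they
  -- avoid the panel interiors at every later halving.
  have hc0 : ∀ j N, cov[pathRefine hab.le (α j) (h j) (m j), refineSum hab.le n N; P] = 0 := by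
    intro j N
    rw [refineSum, covariance_sum_right' (fun l _ => memLp_pathRefine hP _ _ _ _)
      (memLp_pathRefine hP _ _ _ _)]
    exact Finset.sum_eq_zero fun l _ => covariance_pathRefine_eq_zero_of_lattice hP hab hK hn
      (hα j) (hα' j) (hh j) (u j) (v j) (hu j) (hv j) l
  refine iIndepFun_of_tendsto_gaussian
    (G := Submodule.span ℝ (Set.range (pathEval hab.le)))
    (fun X hX => hP.hasGaussianLaw_of_mem_span hab.le hX)
    (fun X hX => hP.integral_of_mem_span hab.le hX)
    (U := fun N o => o.elim (refineSum hab.le n N) fun j => pathRefine hab.le (α j) (h j) (m j))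
    ?_ ?_ ?_ ?_ ?_
  · rintro N (_ | j)
    · exact refineSum_mem_span _ _ _
    · exact refine_mem_span _ _ _ _
  · rintro N (_ | i) (_ | j) hij
    · exact absurd rfl hij
    · exact (covariance_comm _ _).trans (hc0 j N)
    · exact hc0 i N
    · exact hcov i j fun H => hij (by rw [H])
  · rintro (_ | j)
    · exact measurable_trapError hab hn
    · exact measurable_pathRefine _ _ _ _
  · rintro (_ | j) f
    · exact tendsto_refineSum hab hn f
    · exact tendsto_const_nhds
  · rintro (_ | j)
    · simp only [Option.elim_none]
      rw [Real.coe_toNNReal _ (by positivity)]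
      exact tendsto_variance_refineSum hP hab hK hn
    · have hj := hh j
      simp only [Option.elim_some]
      rw [Real.coe_toNNReal _ (by positivity)]
      refine tendsto_const_nhds.congr fun _ => ?_
      exact (variance_refine (fun x => hP.memLp_pathEval hab.le x) hK (hα j) (hα' j) hj).symm

theorem measure_iInter_preimage_of_iIndepFun {Ω ι : Type*} [MeasurableSpace Ω] [Fintype ι]
    {P : Measure Ω} {X : ι → Ω → ℝ} (hX : ∀ i, Measurable (X i)) (hind : iIndepFun X P)
    {s : ι → Set ℝ} (hs : ∀ i, MeasurableSet (s i)) :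
    P (⋂ i, X i ⁻¹' s i) = ∏ i, P.map (X i) (s i) := by
  rw [hind.meas_iInter fun i => ⟨s i, hs i, rfl⟩]
  exact Finset.prod_congr rfl fun i _ => (Measure.map_apply (hX i) (hs i)).symm

/-- The probability that the first call accepts and that the error is too large. -/
theorem measureReal_accept_inter_error (hP : IsCentredGaussianLaw P) (hab : a < b) (hlam : 0 < lam)
    (hK : ∀ x ∈ Set.Icc a b, ∀ y ∈ Set.Icc a b,
      cov[pathEval hab.le x, pathEval hab.le y; P] =
        lam * min x y + p + q * (x + y) + r * (x * y))
    {m : ℕ} (hm : 0 < m) {c τ : ℝ} (hτ : 0 < τ) (hc : 0 ≤ c)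
    (hc2 : c ^ 2 * (lam * (b - a) ^ 3) = 8 * m ^ 2) :
    P.real {f | |pathRefine hab.le a ((b - a) / (2 * m)) m f| < τ ∧
        τ < |trapError hab.le (2 * m) f|} =
      erf (c * τ) * (1 - erf (Real.sqrt 3 * c * τ)) := by
  have hba := sub_pos.2 hab
  have hmR : (0 : ℝ) < m := by exact_mod_cast hm
  obtain ⟨hind, hlaw⟩ := iIndepFun_trapError_pathRefine hP hab hlam hK (n := 2 * m) (by omega)
    (J := Unit) (fun _ => a) (fun _ => (b - a) / (2 * m)) (fun _ => m) (fun _ => le_rfl)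
    (fun _ => by field_simp; linarith) (fun _ => by positivity) (fun _ => 0) (fun _ => 1)
    (fun _ => by simp) (fun _ => by simp) (fun i j hij => absurd rfl hij)
  have hmeas : ∀ o : Option Unit, Measurable (o.elim (trapError hab.le (2 * m))
      fun _ => pathRefine hab.le a ((b - a) / (2 * m)) m) := by
    rintro (_ | j)
    · exact measurable_trapError hab (by omega)
    · exact measurable_pathRefine _ _ _ _
  have hprod := measure_iInter_preimage_of_iIndepFun hmeas hind
    (s := fun o => o.elim {x | τ < |x|} fun _ => {x | |x| < τ}) (by
      rintro (_ | j)
      · exact measurableSet_lt measurable_const measurable_abs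
      · exact measurableSet_lt measurable_abs measurable_const)
  have hset : {f | |pathRefine hab.le a ((b - a) / (2 * m)) m f| < τ ∧
        τ < |trapError hab.le (2 * m) f|} =
      ⋂ o : Option Unit, (o.elim (trapError hab.le (2 * m))
        fun _ => pathRefine hab.le a ((b - a) / (2 * m)) m) ⁻¹'
          (o.elim {x | τ < |x|} fun _ => {x | |x| < τ}) := by
    ext f
    simp [Set.mem_iInter, Option.forall, and_comm]
  -- The variances are `lam * (b - a) ^ 3 / (16 * m ^ 2)` for the refinement and one third of this
  -- for the error, so `1 / √(2w)` is `c` and `√3 * c` respectively.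
  have hsqrt : ∀ w d : ℝ, 0 ≤ d → d ^ 2 * (2 * w) = 1 → τ / Real.sqrt (2 * w) = d * τ := by
    intro w d hd h
    have hd0 : d ≠ 0 := fun h0 => by simp [h0] at h
    have : 2 * w = (d⁻¹) ^ 2 := by field_simp; linarith
    rw [this, Real.sqrt_sq (by positivity)]
    field_simp
  have hv1 : 0 < lam * m * ((b - a) / (2 * m)) ^ 3 / 2 := by positivity
  have hv2 : 0 < lam * (b - a) ^ 3 / (12 * ((2 * m : ℕ) : ℝ) ^ 2) := by positivity
  rw [hset, Measure.real, hprod, Fintype.prod_option, ENNReal.toReal_mul, mul_comm]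
  have hlaw1 := hlaw (some ())
  have hlaw0 := hlaw none
  simp only [Option.elim_none, Option.elim_some] at hlaw0 hlaw1
  simp only [hlaw0, hlaw1, Option.elim_none, Option.elim_some, Finset.univ_unique, Finset.prod_singleton]
  rw [← Measure.real, ← Measure.real, gaussianReal_real_abs_lt _ (Real.toNNReal_pos.2 hv1).ne' hτ.le,
    gaussianReal_real_lt_abs _ (Real.toNNReal_pos.2 hv2).ne' hτ.le, Real.coe_toNNReal _ hv1.le,
    Real.coe_toNNReal _ hv2.le, hsqrt _ c hc, hsqrt _ (Real.sqrt 3 * c) (by positivity)]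
  · rw [mul_pow, Real.sq_sqrt (by norm_num)]
    push_cast
    field_simp
    linarith
  · field_simp
    linarith

/-- With positive probability, the first call subdivides, all the calls that it makes accept, and
the error is too large. -/
theorem measure_subdivide_inter_error_pos (hP : IsCentredGaussianLaw P) (hab : a < b)
    (hlam : 0 < lam)
    (hK : ∀ x ∈ Set.Icc a b, ∀ y ∈ Set.Icc a b,
      cov[pathEval hab.le x, pathEval hab.le y; P] =
        lam * min x y + p + q * (x + y) + r * (x * y))
    {m k : ℕ} (hm : 0 < m) (hk : 0 < k) (hk2 : Even k) {σ : ℝ} (hσ : 0 < σ) (τ : ℝ) :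
    0 < P {f | τ < |trapError hab.le (k * (2 * m)) f| ∧
      τ < |pathRefine hab.le a ((b - a) / (2 * m)) m f| ∧
        ∀ i : Fin k, |pathRefine hab.le (a + (b - a) * (i : ℕ) / k)
          ((b - a) / (k * (2 * m))) m f| < σ} := by
  have := hP.isProbabilityMeasure
  have hba := sub_pos.2 hab
  have hmR : (0 : ℝ) < m := by exact_mod_cast hm
  have hkR : (0 : ℝ) < k := by exact_mod_cast hk
  -- The index `none` stands for the first call and `some i` for the `i`-th subcall.
  set α : Option (Fin k) → ℝ := fun o => o.elim a fun i => a + (b - a) * (i : ℕ) / k with hαdef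
  set h : Option (Fin k) → ℝ :=
    fun o => o.elim ((b - a) / (2 * m)) fun _ => (b - a) / (k * (2 * m)) with hhdef
  have hα : ∀ o, a ≤ α o := by
    rintro (_ | i)
    · exact le_rfl
    · simp only [hαdef, Option.elim_some, le_add_iff_nonneg_right]
      positivity
  have hend : ∀ i : Fin k, α (some i) + 2 * m * h (some i) = a + (b - a) * ((i : ℕ) + 1) / k := by
    intro i
    simp only [hαdef, hhdef, Option.elim_some]
    field_simp
    ring
  have hα' : ∀ o, α o + 2 * m * h o ≤ b := by
    rintro (_ | i)
    · simp only [hαdef, hhdef, Option.elim_none]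
      field_simp
      linarith
    · rw [hend]
      have hi : ((i : ℕ) : ℝ) + 1 ≤ k := by exact_mod_cast i.2
      have : (b - a) * ((i : ℕ) + 1) / k ≤ b - a := by
        rw [div_le_iff₀ hkR]
        gcongr
      linarith
  have hh : ∀ o, 0 < h o := by
    rintro (_ | i)
    · exact div_pos hba (by positivity)
    · exact div_pos hba (by positivity)
  have hnone : ∀ i : Fin k, cov[pathRefine hab.le (α none) (h none) m,
      pathRefine hab.le (α (some i)) (h (some i)) m; P] = 0 := by
    intro i
    -- Evenness enters here: the node spacing `(b - a) / (2 * m)` of the first refinement is `k / 2`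
    -- panels of width `(b - a) / (k * m)` of a subcall, and this number must be an integer.
    obtain ⟨k', hk'⟩ := hk2
    have hk'R : (k : ℝ) = k' + k' := by exact_mod_cast hk'
    refine covariance_refine_eq_zero_of_lattice (fun x => hP.memLp_pathEval hab.le x) hK
      (hα none) (hα' none) (hh none).le (hα _) (hα' _) (hh _).le (-(m * (i : ℕ))) k' ?_ ?_
    · simp only [hαdef, hhdef, Option.elim_some, Option.elim_none]
      push_cast
      field_simp
      ring
    · simp only [hhdef, Option.elim_some, Option.elim_none]
      push_cast
      field_simp
      linarith
  have hlt : ∀ i j : Fin k, i < j → cov[pathRefine hab.le (α (some i)) (h (some i)) m,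
      pathRefine hab.le (α (some j)) (h (some j)) m; P] = 0 := by
    intro i j hij
    refine covariance_refine_eq_zero_of_disjoint (fun x => hP.memLp_pathEval hab.le x) hK
      (hα _) (hα' _) (hh _).le (hα _) (hα' _) (hh _).le ?_
    rw [hend]
    have hij : ((i : ℕ) : ℝ) + 1 ≤ (j : ℕ) := by exact_mod_cast hij
    simp only [hαdef, Option.elim_some]
    gcongr
  obtain ⟨hind, hlaw⟩ := iIndepFun_trapError_pathRefine hP hab hlam hK (n := k * (2 * m))
    (by positivity) α h (fun _ => m) hα hα' (fun o => (hh o).le)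
    -- Starting points and spacings in units of `(b - a) / (k * (2 * m))`, the panel width of the
    -- final rule.
    (fun o => o.elim 0 fun i => 2 * m * (i : ℕ)) (fun o => o.elim k fun _ => 1)
    (by
      rintro (_ | i)
      · simp [hαdef]
      · simp only [hαdef, Option.elim_some]
        push_cast
        field_simp)
    (by
      rintro (_ | i)
      · simp only [hhdef, Option.elim_none]
        push_cast
        field_simp
      · simp [hhdef])
    (by
      rintro (_ | i) (_ | j) hij
      · exact absurd rfl hij
      · exact hnone j
      · rw [covariance_comm]
        exact hnone i
      · rcases lt_or_gt_of_ne fun H : i = j => hij (by rw [H]) with H | H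
        · exact hlt i j H
        · rw [covariance_comm]
          exact hlt j i H)
  have hmeas : ∀ o : Option (Option (Fin k)), Measurable (o.elim (trapError hab.le (k * (2 * m)))
      fun o => pathRefine hab.le (α o) (h o) m) := by
    rintro (_ | j)
    · exact measurable_trapError hab (by positivity)
    · exact measurable_pathRefine _ _ _ _
  have hprod := measure_iInter_preimage_of_iIndepFun hmeas hind
    (s := fun o => o.elim {x | τ < |x|} fun o => o.elim {x | τ < |x|} fun _ => {x | |x| < σ}) (by
      rintro (_ | _ | j)
      · exact measurableSet_lt measurable_const measurable_abs
      · exact measurableSet_lt measurable_const measurable_abs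
      · exact measurableSet_lt measurable_abs measurable_const)
  have hset : {f | τ < |trapError hab.le (k * (2 * m)) f| ∧
      τ < |pathRefine hab.le a ((b - a) / (2 * m)) m f| ∧
        ∀ i : Fin k, |pathRefine hab.le (a + (b - a) * (i : ℕ) / k)
          ((b - a) / (k * (2 * m))) m f| < σ} =
      ⋂ o : Option (Option (Fin k)), (o.elim (trapError hab.le (k * (2 * m)))
        fun o => pathRefine hab.le (α o) (h o) m) ⁻¹'
          (o.elim {x | τ < |x|} fun o => o.elim {x | τ < |x|} fun _ => {x | |x| < σ}) := by
    ext f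
    simp [Set.mem_iInter, Option.forall, hαdef, hhdef]
  rw [hset, hprod, pos_iff_ne_zero, Finset.prod_ne_zero_iff]
  rintro (_ | _ | j) -
  · rw [hlaw]
    refine (gaussianReal_lt_abs_pos _ (Real.toNNReal_pos.2 ?_).ne' _).ne'
    simp only [Option.elim_none]
    positivity
  · rw [hlaw]
    refine (gaussianReal_lt_abs_pos _ (Real.toNNReal_pos.2 ?_).ne' _).ne'
    have := hh none
    simp only [Option.elim_some]
    positivity
  · rw [hlaw]
    refine (gaussianReal_abs_lt_pos _ (Real.toNNReal_pos.2 ?_).ne' hσ).ne'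
    have := hh (some j)
    simp only [Option.elim_some]
    positivity

theorem lt_abs_adapTrapError_of_accept (hab : a ≤ b) {ρ τ : ℝ} {m : ℕ} (k : ℕ) (hm : 0 < m)
    {f : C(Set.Icc a b, ℝ)} (hτ : 0 < τ)
    (h : |pathRefine hab a ((b - a) / (2 * m)) m f| < τ) (herr : τ < |trapError hab (2 * m) f|) :
    ENNReal.ofReal τ < (adapTrapError ρ m k τ a b (Set.IccExtend hab f)).abs := by
  rw [pathRefine, ← trap_two_mul_sub_trap _ _ _ hm] at h
  have e := adapTrapError_of_accept (ρ := ρ) (k := k) h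
  change ENNReal.ofReal τ < (adapTrapError ρ m k τ a b fun x => pathEval hab x f).abs
  rw [e, EReal.abs_def]
  exact (ENNReal.ofReal_lt_ofReal_iff (hτ.trans herr)).2 herr

theorem lt_abs_adapTrapError_of_subdivide (hab : a ≤ b) {ρ τ : ℝ} {m k : ℕ} (hm : 0 < m)
    (hk : 0 < k) {f : C(Set.Icc a b, ℝ)} (hτ : 0 < τ)
    (herr : τ < |trapError hab (k * (2 * m)) f|)
    (h : τ < |pathRefine hab a ((b - a) / (2 * m)) m f|)
    (hsub : ∀ i : Fin k, |pathRefine hab (a + (b - a) * (i : ℕ) / k)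
      ((b - a) / (k * (2 * m))) m f| < ρ * τ) :
    ENNReal.ofReal τ < (adapTrapError ρ m k τ a b (Set.IccExtend hab f)).abs := by
  rw [pathRefine, ← trap_two_mul_sub_trap _ _ _ hm] at h
  have hkR : (0 : ℝ) < k := by exact_mod_cast hk
  have hmR : (0 : ℝ) < m := by exact_mod_cast hm
  have e := adapTrapError_of_subdivide (ρ := ρ) hm hk h.le.not_gt fun i hi => by
    rw [trap_two_mul_sub_trap _ _ _ hm]
    convert! hsub ⟨i, hi⟩ using 2
    rw [pathRefine]
    congr 1
    field_simp
    ring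
  change ENNReal.ofReal τ < (adapTrapError ρ m k τ a b fun x => pathEval hab x f).abs
  rw [e, EReal.abs_def]
  exact (ENNReal.ofReal_lt_ofReal_iff (hτ.trans herr)).2 herr

end Error

end AdaptiveCubature

/-! ### The lower bound on the failure probability. -/

theorem proposition1 (a b : ℝ) (hab : a < b) (P : Measure C(Set.Icc a b, ℝ))
    (hP : AdaptiveCubature.IsCentredGaussianLaw P)
    (hlin : AdaptiveCubature.HasPiecewiseLinearConditionalMean P)
    (hnontriv : ¬ AdaptiveCubature.IsAlmostSurelyAffine P) :
    ∃ lam : ℝ, 0 < lam ∧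
      (∃ p q r : ℝ, ∀ x y : Set.Icc a b,
        cov[fun f : C(Set.Icc a b, ℝ) => f x, fun f : C(Set.Icc a b, ℝ) => f y; P]
          = lam * min (x : ℝ) y + p + q * ((x : ℝ) + y) + r * ((x : ℝ) * y)) ∧
      ∀ (ρ : ℝ) (m k : ℕ), 0 < ρ → 0 < m → 0 < k → Even k →
        ∀ (c : ℝ), c = 2 * Real.sqrt 2 * m * lam ^ (-(1 / 2) : ℝ) * (b - a) ^ (-(3 / 2) : ℝ) →
          ∀ τ : ℝ, 0 < τ →
            AdaptiveCubature.erf (c * τ) * (1 - AdaptiveCubature.erf (Real.sqrt 3 * c * τ))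
              < P.real {f : C(Set.Icc a b, ℝ) | ENNReal.ofReal τ <
                  (AdaptiveCubature.adapTrapError ρ m k τ a b (Set.IccExtend hab.le f)).abs} := by
  open AdaptiveCubature in
  have := hP.isProbabilityMeasure
  have hba := sub_pos.2 hab
  obtain ⟨lam, p, q, r, hK⟩ := hlin.exists_covariance_eq hab hP
  have hlam := pos_of_not_isAlmostSurelyAffine hab hP hnontriv hK
  refine ⟨lam, hlam, ⟨p, q, r, fun x y => ?_⟩, ?_⟩
  · have := hK x x.2 y y.2
    rwa [pathEval_of_mem _ x.2, pathEval_of_mem _ y.2] at this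
  intro ρ m k hρ hm hk hk2 c hc τ hτ
  have hc0 : 0 ≤ c := by rw [hc]; positivity
  have hc2 : c ^ 2 * (lam * (b - a) ^ 3) = 8 * m ^ 2 := by
    have h1 : (lam ^ (-(1 / 2) : ℝ)) ^ 2 = lam⁻¹ := by
      rw [← Real.rpow_natCast, ← Real.rpow_mul hlam.le, ← Real.rpow_neg_one]
      norm_num
    have h2 : ((b - a) ^ (-(3 / 2) : ℝ)) ^ 2 = ((b - a) ^ 3)⁻¹ := by
      rw [← Real.rpow_natCast, ← Real.rpow_mul hba.le, ← Real.rpow_natCast, ← Real.rpow_neg hba.le]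
      norm_num
    rw [hc, mul_pow, mul_pow, mul_pow, mul_pow, h1, h2, Real.sq_sqrt (by norm_num)]
    field_simp
    norm_num
  set E₁ := {f | |pathRefine hab.le a ((b - a) / (2 * m)) m f| < τ ∧
    τ < |trapError hab.le (2 * m) f|} with hE₁
  set E₂ := {f | τ < |trapError hab.le (k * (2 * m)) f| ∧
    τ < |pathRefine hab.le a ((b - a) / (2 * m)) m f| ∧
      ∀ i : Fin k, |pathRefine hab.le (a + (b - a) * (i : ℕ) / k)
        ((b - a) / (k * (2 * m))) m f| < ρ * τ} with hE₂
  -- The first call accepts on `E₁` and subdivides on `E₂`.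
  have hdisj : Disjoint E₁ E₂ :=
    Set.disjoint_left.2 fun f h1 h2 => (h1.1.trans h2.2.1).false
  have hm₁ : MeasurableSet E₁ :=
    (measurableSet_lt (measurable_pathRefine _ _ _ _).abs measurable_const).inter
      (measurableSet_lt measurable_const (measurable_trapError hab (by omega)).abs)
  rw [← measureReal_accept_inter_error hP hab hlam hK hm hτ hc0 hc2, ← hE₁]
  have hpos : 0 < P.real E₂ := ENNReal.toReal_pos
    (measure_subdivide_inter_error_pos hP hab hlam hK hm hk hk2 (mul_pos hρ hτ) τ).ne'
    (measure_ne_top _ _)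
  calc P.real E₁ < P.real E₁ + P.real E₂ := by linarith
    _ = P.real (E₁ ∪ E₂) := (measureReal_union' hdisj hm₁).symm
    -- Monotonicity holds for arbitrary sets, so measurability of the failure event is not required.
    _ ≤ _ := measureReal_mono (Set.union_subset
      (fun f hf => lt_abs_adapTrapError_of_accept hab.le k hm hτ hf.1 hf.2)
      fun f hf => lt_abs_adapTrapError_of_subdivide hab.le hm hk hτ hf.1 hf.2.1 hf.2.2)
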